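/- Let $n\ge 0$ and let $K\subset\mathbb{R}^n$ be a convex body (a nonempty compact convex set) which is centrally symmetric, i.e. $K=2c-K$ for some $c\in\mathbb{R}^n$. Let $h_K(x)=\max_{y\in K}\langle x,y\rangle$ be its support function. For $u\in S^{n-1}$ let $O(u)$ be the compact group of orthogonal transformations $T$ of $\mathbb{R}^n$ with $Tu=u$, let $m$ be its normalized Haar measure, and let the $u$-spin $K_u$ of $K$ be the convex body with support function $$h_{K_u}(x)=(S_uh_K)(x)=\int_{O(u)}h_K(Tx)\,dm(T),\qquad x\in\mathbb{R}^n.$$ A zonoid is a convex body that is a limit, in the Hausdorff metric, of zonotopes (finite Minkowski sums of closed segments). Then $K$ is a zonoid if and only if $K_u$ is a zonoid for every $u\in S^{n-1}$. -/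

import Mathlib

open MeasureTheory
open scoped Pointwise

noncomputable section

/-- `ℝⁿ` with its Euclidean structure. -/
abbrev Rn (n : ℕ) : Type := EuclideanSpace ℝ (Fin n)

variable {n : ℕ}

/-! ### Convex bodies: support functions, symmetry, zonoids -/

/-- The support function `h_K(x) = max_{y ∈ K} ⟨x, y⟩`. -/
def supportFunction (K : ConvexBody (Rn n)) (x : Rn n) : ℝ :=
  sSup ((fun y : Rn n => inner ℝ x y) '' (K : Set (Rn n)))

/-- `K` is symmetric about some point `c`. -/
def IsCentrallySymmetric (K : ConvexBody (Rn n)) : Prop :=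
  ∃ c : Rn n, ∀ x ∈ K, (2 : ℝ) • c - x ∈ K

/-- A zonotope is a finite Minkowski sum of closed segments. -/
def IsZonotope (Z : ConvexBody (Rn n)) : Prop :=
  ∃ (k : ℕ) (a b : Fin k → Rn n), (Z : Set (Rn n)) = ∑ i, segment ℝ (a i) (b i)

/-- A zonoid is a limit of zonotopes; the topology on `ConvexBody` is that of the
Hausdorff metric. -/
def IsZonoid (K : ConvexBody (Rn n)) : Prop :=
  K ∈ closure {Z : ConvexBody (Rn n) | IsZonotope Z}

/-! ### The group `O(u)` and the averaging operator `S_u` -/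

/-- The orthogonal group of `ℝⁿ`, as a topological group. -/
abbrev OrthGroup (n : ℕ) : Type := unitary (Rn n →L[ℝ] Rn n)

instance continuousStar_clm : ContinuousStar (Rn n →L[ℝ] Rn n) :=
  ⟨(ContinuousLinearMap.adjoint (𝕜 := ℝ) (E := Rn n) (F := Rn n)).continuous⟩

/-- The group `O(u)` of orthogonal transformations that keep `u` fixed. -/
def orthStabilizer (u : Rn n) : Subgroup (OrthGroup n) where
  carrier := {T | (T : Rn n →L[ℝ] Rn n) u = u}
  one_mem' := by simp
  mul_mem' := by
    intro S T hS hT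
    simp only [Set.mem_ofPred_eq] at *
    simp [hS, hT]
  inv_mem' := by
    intro T hT
    simp only [Set.mem_ofPred_eq] at *
    have h : ((T⁻¹ * T : OrthGroup n) : Rn n →L[ℝ] Rn n) u = u := by simp
    simpa only [Submonoid.coe_mul, mul_apply_eq_comp, hT] using h

theorem orthGroup_norm_apply (T : OrthGroup n) (x : Rn n) :
    ‖(T : Rn n →L[ℝ] Rn n) x‖ = ‖x‖ :=
  ContinuousLinearMap.norm_map_of_mem_unitary T.2 x

instance orthGroup_compactSpace : CompactSpace (OrthGroup n) := by
  refine isCompact_iff_compactSpace.mp (Metric.isCompact_of_isClosed_isBounded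
    isClosed_unitary ((isBounded_iff_forall_norm_le).mpr ⟨1, fun T hT => ?_⟩))
  refine ContinuousLinearMap.opNorm_le_bound _ zero_le_one fun x => ?_
  rw [one_mul, ContinuousLinearMap.norm_map_of_mem_unitary hT]

instance orthStabilizer_compactSpace (u : Rn n) : CompactSpace (orthStabilizer u) := by
  refine isCompact_iff_compactSpace.mp (IsClosed.isCompact ?_)
  exact isClosed_eq (continuous_subtype_val.clm_apply continuous_const) continuous_const

/-- The normalized Haar measure on `O(u)`. -/
def haarO (u : Rn n) : Measure (orthStabilizer u) :=
  Measure.haarMeasure ⊤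

instance haarO_isProbabilityMeasure (u : Rn n) : IsProbabilityMeasure (haarO u) :=
  ⟨by simpa [haarO] using
    Measure.haarMeasure_self (K₀ := (⊤ : TopologicalSpace.PositiveCompacts (orthStabilizer u)))⟩

/-- `(S_u f)(x) = ∫_{O(u)} f(Tx) dm(T)`. -/
def spinAverage (u : Rn n) (f : Rn n → ℝ) (x : Rn n) : ℝ :=
  ∫ T : orthStabilizer u, f (((T : OrthGroup n) : Rn n →L[ℝ] Rn n) x) ∂(haarO u)

/-! ### The spin of a convex body -/

theorem supportFunction_bddAbove (K : ConvexBody (Rn n)) (x : Rn n) :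
    BddAbove ((fun y : Rn n => inner ℝ x y) '' (K : Set (Rn n))) :=
  (K.isCompact.image (by fun_prop)).bddAbove

theorem inner_le_supportFunction (K : ConvexBody (Rn n)) (x : Rn n) {y : Rn n} (hy : y ∈ K) :
    inner ℝ x y ≤ supportFunction K x :=
  le_csSup (supportFunction_bddAbove K x) ⟨y, hy, rfl⟩

theorem supportFunction_le (K : ConvexBody (Rn n)) (x : Rn n) {a : ℝ}
    (h : ∀ y ∈ K, inner ℝ x y ≤ a) : supportFunction K x ≤ a := by
  refine csSup_le (K.nonempty.image _) ?_
  rintro _ ⟨y, hy, rfl⟩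
  exact h y hy

theorem supportFunction_add_le (K : ConvexBody (Rn n)) (x y : Rn n) :
    supportFunction K (x + y) ≤ supportFunction K x + supportFunction K y := by
  refine supportFunction_le K _ fun z hz => ?_
  rw [inner_add_left]
  exact add_le_add (inner_le_supportFunction K x hz) (inner_le_supportFunction K y hz)

theorem supportFunction_smul_le (K : ConvexBody (Rn n)) {c : ℝ} (hc : 0 < c) (x : Rn n) :
    supportFunction K (c • x) ≤ c * supportFunction K x := by
  refine supportFunction_le K _ fun z hz => ?_
  rw [real_inner_smul_left]
  exact mul_le_mul_of_nonneg_left (inner_le_supportFunction K x hz) hc.le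

theorem supportFunction_smul (K : ConvexBody (Rn n)) {c : ℝ} (hc : 0 < c) (x : Rn n) :
    supportFunction K (c • x) = c * supportFunction K x := by
  refine le_antisymm (supportFunction_smul_le K hc x) ?_
  have h := supportFunction_smul_le K (inv_pos.mpr hc) (c • x)
  rw [smul_smul, inv_mul_cancel₀ hc.ne', one_smul] at h
  calc c * supportFunction K x ≤ c * (c⁻¹ * supportFunction K (c • x)) :=
        mul_le_mul_of_nonneg_left h hc.le
    _ = supportFunction K (c • x) := by field_simp

theorem exists_supportFunction_le_norm (K : ConvexBody (Rn n)) :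
    ∃ R : ℝ, 0 ≤ R ∧ ∀ x, supportFunction K x ≤ R * ‖x‖ := by
  obtain ⟨R, hR⟩ := isBounded_iff_forall_norm_le.mp K.isBounded
  have hR0 : 0 ≤ R := by
    obtain ⟨y, hy⟩ := K.nonempty
    exact (norm_nonneg y).trans (hR y hy)
  refine ⟨R, hR0, fun x => supportFunction_le K x fun y hy => ?_⟩
  calc inner ℝ x y ≤ ‖x‖ * ‖y‖ := real_inner_le_norm x y
    _ ≤ ‖x‖ * R := mul_le_mul_of_nonneg_left (hR y hy) (norm_nonneg x)
    _ = R * ‖x‖ := mul_comm _ _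

theorem supportFunction_continuous (K : ConvexBody (Rn n)) : Continuous (supportFunction K) := by
  obtain ⟨R, hR0, hR⟩ := exists_supportFunction_le_norm K
  refine (LipschitzWith.of_le_add_mul ⟨R, hR0⟩ fun x y => ?_).continuous
  have h := supportFunction_add_le K y (x - y)
  rw [add_sub_cancel] at h
  calc supportFunction K x ≤ _ := h
    _ ≤ supportFunction K y + R * dist x y := by
      rw [dist_eq_norm]
      exact add_le_add le_rfl (hR _)

theorem continuous_orthStabilizer_apply (u x : Rn n) :
    Continuous fun T : orthStabilizer u => ((T : OrthGroup n) : Rn n →L[ℝ] Rn n) x :=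
  (continuous_subtype_val.comp continuous_subtype_val).clm_apply continuous_const

theorem spinAverage_integrable (u : Rn n) {f : Rn n → ℝ} (hf : Continuous f) (x : Rn n) :
    Integrable (fun T : orthStabilizer u => f (((T : OrthGroup n) : Rn n →L[ℝ] Rn n) x))
      (haarO u) :=
  (hf.comp (continuous_orthStabilizer_apply u x)).integrable_of_hasCompactSupport
    (HasCompactSupport.of_compactSpace _)

/-- The convex set cut out by the half-spaces `⟨x, y⟩ ≤ (S_u h_K)(x)`. -/
def spinSet (u : Rn n) (K : ConvexBody (Rn n)) : Set (Rn n) :=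
  {y | ∀ x : Rn n, inner ℝ x y ≤ spinAverage u (supportFunction K) x}

theorem spinAverage_supportFunction_add_le (u : Rn n) (K : ConvexBody (Rn n)) (x y : Rn n) :
    spinAverage u (supportFunction K) (x + y) ≤
      spinAverage u (supportFunction K) x + spinAverage u (supportFunction K) y := by
  have hc := supportFunction_continuous K
  unfold spinAverage
  rw [← integral_add (spinAverage_integrable u hc x) (spinAverage_integrable u hc y)]
  refine integral_mono (spinAverage_integrable u hc (x + y))
    ((spinAverage_integrable u hc x).add (spinAverage_integrable u hc y)) fun T => ?_
  simp only [map_add]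
  exact supportFunction_add_le K _ _

theorem spinAverage_supportFunction_smul (u : Rn n) (K : ConvexBody (Rn n)) {c : ℝ} (hc : 0 < c)
    (x : Rn n) : spinAverage u (supportFunction K) (c • x) =
      c * spinAverage u (supportFunction K) x := by
  unfold spinAverage
  rw [← integral_const_mul]
  simp only [map_smul, supportFunction_smul K hc]

theorem exists_mem_spinSet (u : Rn n) (K : ConvexBody (Rn n)) (x₀ : Rn n) :
    ∃ y ∈ spinSet u K, inner ℝ x₀ y = spinAverage u (supportFunction K) x₀ := by
  set N := spinAverage u (supportFunction K) with hN
  have hhom : ∀ c : ℝ, 0 < c → ∀ x, N (c • x) = c * N x :=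
    fun c hc x => spinAverage_supportFunction_smul u K hc x
  have hadd : ∀ x y, N (x + y) ≤ N x + N y := spinAverage_supportFunction_add_le u K
  have h0 : N 0 = 0 := by
    have := hhom 2 two_pos 0
    rw [smul_zero] at this
    linarith
  have key : ∃ g : Rn n →ₗ[ℝ] ℝ, g x₀ = N x₀ ∧ ∀ x, g x ≤ N x := by
    by_cases hx : x₀ = 0
    · obtain ⟨g, -, hg⟩ := exists_extension_of_le_sublinear
        (⟨⊥, 0⟩ : Rn n →ₗ.[ℝ] ℝ) N hhom hadd (by
          rintro ⟨x, hx⟩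
          have hx' : x = 0 := by simpa using hx
          subst hx'
          change (0 : ℝ) ≤ N 0
          rw [h0])
      exact ⟨g, by rw [hx, map_zero, h0], hg⟩
    · obtain ⟨g, hg₁, hg⟩ := exists_extension_of_le_sublinear
        (LinearPMap.mkSpanSingleton x₀ (N x₀) hx : Rn n →ₗ.[ℝ] ℝ) N hhom hadd (by
          rintro ⟨x, hx'⟩
          obtain ⟨c, rfl⟩ := Submodule.mem_span_singleton.mp hx'
          rw [LinearPMap.mkSpanSingleton'_apply, smul_eq_mul]
          rcases lt_trichotomy c 0 with hc | hc | hc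
          · have h1 := hhom (-c) (neg_pos.mpr hc) x₀
            have h2 := hadd (c • x₀) ((-c) • x₀)
            rw [← add_smul, add_neg_cancel, zero_smul, h0, h1] at h2
            change c * N x₀ ≤ N (c • x₀)
            linarith
          · subst hc
            simp [h0]
          · exact (hhom c hc x₀).ge)
      refine ⟨g, ?_, hg⟩
      have := hg₁ ⟨x₀, Submodule.mem_span_singleton_self x₀⟩
      rw [LinearPMap.mkSpanSingleton_apply] at this
      exact this
  obtain ⟨g, hg₁, hg⟩ := key
  set y := (InnerProductSpace.toDual ℝ (Rn n)).symm (LinearMap.toContinuousLinearMap g) with hy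
  have hgy : ∀ x, inner ℝ x y = g x := fun x => by
    rw [real_inner_comm, hy, InnerProductSpace.toDual_symm_apply]
    rfl
  exact ⟨y, fun x => (hgy x).trans_le (hg x), (hgy x₀).trans hg₁⟩

theorem spinSet_convex (u : Rn n) (K : ConvexBody (Rn n)) : Convex ℝ (spinSet u K) := by
  intro y hy z hz a b ha hb hab x
  rw [inner_add_right, real_inner_smul_right, real_inner_smul_right]
  calc a * inner ℝ x y + b * inner ℝ x z
      ≤ a * spinAverage u (supportFunction K) x + b * spinAverage u (supportFunction K) x :=
        add_le_add (mul_le_mul_of_nonneg_left (hy x) ha) (mul_le_mul_of_nonneg_left (hz x) hb)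
    _ = spinAverage u (supportFunction K) x := by rw [← add_mul, hab, one_mul]

theorem spinSet_isCompact (u : Rn n) (K : ConvexBody (Rn n)) : IsCompact (spinSet u K) := by
  obtain ⟨R, hR0, hR⟩ := exists_supportFunction_le_norm K
  refine Metric.isCompact_of_isClosed_isBounded ?_ (isBounded_iff_forall_norm_le.mpr
    ⟨R, fun y hy => ?_⟩)
  · unfold spinSet
    simp only [Set.ofPred_forall]
    exact isClosed_iInter fun x => isClosed_le (by fun_prop) continuous_const
  · have h1 : spinAverage u (supportFunction K) y ≤ R * ‖y‖ := by
      calc spinAverage u (supportFunction K) y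
          ≤ ∫ _ : orthStabilizer u, R * ‖y‖ ∂(haarO u) := by
            refine integral_mono (spinAverage_integrable u (supportFunction_continuous K) y)
              (integrable_const _) fun T => (hR _).trans_eq ?_
            rw [orthGroup_norm_apply]
        _ = R * ‖y‖ := by simp
    have h2 := (hy y).trans h1
    rw [real_inner_self_eq_norm_sq] at h2
    rcases (norm_nonneg y).eq_or_lt with h | h
    · rw [← h]
      exact hR0
    · nlinarith

/-- The `u`-spin `K_u` of `K`: the convex body whose support function is `S_u h_K`
(see `supportFunction_spin`). -/
def spin (u : Rn n) (K : ConvexBody (Rn n)) : ConvexBody (Rn n) where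
  carrier := spinSet u K
  convex' := spinSet_convex u K
  isCompact' := spinSet_isCompact u K
  nonempty' := let ⟨y, hy, _⟩ := exists_mem_spinSet u K 0; ⟨y, hy⟩

/-- The defining property of the spin: `h_{K_u} = S_u h_K`. -/
theorem supportFunction_spin (u : Rn n) (K : ConvexBody (Rn n)) (x : Rn n) :
    supportFunction (spin u K) x = spinAverage u (supportFunction K) x := by
  refine le_antisymm (supportFunction_le _ x fun y hy => hy x) ?_
  obtain ⟨y, hy, hxy⟩ := exists_mem_spinSet u K x
  rw [← hxy]
  exact inner_le_supportFunction (spin u K) x hy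

end

/-! On the unit sphere, support functions embed convex bodies isometrically into continuous
functions, and zonoids correspond to a closed convex cone: the closure of the functions `⟨c, x⟩ + ∑
|⟨a i, x⟩|`. The cone is stable under rotations and under averages against probability measures.
Since `S_u h_K` is a Haar average of rotates of `h_K`, spins of zonoids are zonoids.

For the converse, for each `s` there is an even zonal kernel `k_s` whose cosine transform is
explicit and nonnegative: `∫ |⟨x, w⟩| k_s(⟨u, w⟩) dw = Q(s⟨x, u⟩)` over the sphere, with `Q =
coshKernel` (`integral_abs_inner_mul_zonalKernel`). Let `F(u) = ∫ f(w) k_s(⟨u, w⟩) dw`, where `f` is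
`h_K` minus its linear part `⟨c, ·⟩`. The weight `k_s(⟨u, ·⟩)` is invariant under `O(u)`, so `F(u)`
does not change when `h_K` is replaced by `S_u h_K` (`zonalAverage_spinAverage`). If `K_u` is a
zonoid, the latter is a limit of sums of a linear function, which the even kernel kills, and of
functions `|⟨a, ·⟩|`, on which the average is a nonnegative multiple of a value of `Q`. Hence `F(u)
≥ 0` for every `u`; no sign of `k_s` itself is needed.

The cosine transform of the nonnegative function `F` therefore lies in the cone. By Fubini it equals
`y ↦ ∫ f(w) Q(s⟨y, w⟩) dw` (`integral_abs_inner_mul_zonalAverage`). For suitable `s`, the kernel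
`Q(st)` is concentrated near `t = ±1` (`coshKernel_concentration`), so after normalization these
functions approximate the even function `f` uniformly (`exists_smoothing_close`). As the cone is
closed, `f` belongs to it, and adding back the linear part gives `h_K`.

The kernel comes from Gaussian integrals: `|a|` is a superposition of `1 - cos(τa)`, Gaussian
averages of cosines are explicit, and rotation invariance passes from `ℝⁿ` to the sphere. Integrals
over the sphere are written as integrals over the orthogonal group along the orbit of a unit vector
`e`. -/

open MeasureTheory
open scoped Pointwise

noncomputable section

variable {n : ℕ}

/-! ### Support functions restricted to the unit sphere -/

/-- The support function of a convex body as a continuous function on the unit sphere. -/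
def supportOnSphere (K : ConvexBody (Rn n)) : C(Metric.sphere (0 : Rn n) 1, ℝ) :=
  ⟨fun x => supportFunction K x, (supportFunction_continuous K).comp continuous_subtype_val⟩

@[simp]
theorem supportOnSphere_apply (K : ConvexBody (Rn n)) (x : Metric.sphere (0 : Rn n) 1) :
    supportOnSphere K x = supportFunction K x := rfl

theorem supportFunction_le_add_dist (K L : ConvexBody (Rn n)) {x : Rn n} (hx : ‖x‖ = 1) :
    supportFunction K x ≤ supportFunction L x + dist K L := by
  refine supportFunction_le K x fun y hy => le_of_forall_pos_le_add fun ε hε => ?_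
  have hlt : Metric.hausdorffDist (K : Set (Rn n)) L < dist K L + ε := by
    rw [ConvexBody.hausdorffDist_coe]
    linarith
  obtain ⟨z, hz, hyz⟩ :=
    Metric.exists_dist_lt_of_hausdorffDist_lt hy hlt ConvexBody.hausdorffEDist_ne_top
  have h1 : inner ℝ x (y - z) ≤ dist y z := by
    have := real_inner_le_norm x (y - z)
    rwa [hx, one_mul, ← dist_eq_norm] at this
  rw [inner_sub_right] at h1
  linarith [inner_le_supportFunction L x hz]

/-- Let `p` be the point of `L` nearest to `y`. In the unit direction of `y - p`, the body `L` is
supported at `p`, so the excess of `h_K` over `h_L` there is at least `‖y - p‖`. -/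
theorem exists_dist_le_of_supportFunction_le (K L : ConvexBody (Rn n)) {ε : ℝ} (hε : 0 ≤ ε)
    (h : ∀ x : Rn n, ‖x‖ = 1 → supportFunction K x ≤ supportFunction L x + ε)
    {y : Rn n} (hy : y ∈ K) : ∃ z ∈ L, dist y z ≤ ε := by
  obtain ⟨p, hp, hmin⟩ :=
    exists_norm_eq_iInf_of_complete_convex L.nonempty L.isClosed.isComplete L.convex y
  have hproj := (norm_eq_iInf_iff_real_inner_le_zero L.convex hp).mp hmin
  refine ⟨p, hp, ?_⟩
  rw [dist_eq_norm]
  rcases (norm_nonneg (y - p)).eq_or_lt with h0 | h0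
  · rw [← h0]
    exact hε
  set x := ‖y - p‖⁻¹ • (y - p) with hx
  have hx1 : ‖x‖ = 1 := by
    rw [hx, norm_smul, norm_inv, norm_norm, inv_mul_cancel₀ h0.ne']
  have hL : supportFunction L x ≤ inner ℝ x p := by
    refine supportFunction_le L x fun z hz => ?_
    have := hproj z hz
    rw [← sub_nonpos, ← inner_sub_right, hx, real_inner_smul_left]
    exact mul_nonpos_of_nonneg_of_nonpos (by positivity) this
  have hxy : inner ℝ x (y - p) = ‖y - p‖ := by
    rw [hx, real_inner_smul_left, real_inner_self_eq_norm_sq]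
    field_simp
  rw [inner_sub_right] at hxy
  linarith [inner_le_supportFunction K x hy, h x hx1]

theorem supportOnSphere_isometry :
    Isometry (supportOnSphere : ConvexBody (Rn n) → C(Metric.sphere (0 : Rn n) 1, ℝ)) := by
  refine Isometry.of_dist_eq fun K L => le_antisymm ?_ ?_
  · rw [ContinuousMap.dist_le dist_nonneg]
    rintro ⟨x, hx⟩
    have hx1 : ‖x‖ = 1 := by simpa using hx
    have h1 := supportFunction_le_add_dist K L hx1
    have h2 := supportFunction_le_add_dist L K hx1
    rw [dist_comm L K] at h2
    rw [Real.dist_eq, abs_le]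
    simp only [supportOnSphere_apply]
    constructor <;> linarith
  · have hx : ∀ x : Rn n, ‖x‖ = 1 → |supportFunction K x - supportFunction L x| ≤
        dist (supportOnSphere K) (supportOnSphere L) := fun x hx =>
      ContinuousMap.dist_apply_le_dist (f := supportOnSphere K) (g := supportOnSphere L)
        ⟨x, by simpa using hx⟩
    rw [← ConvexBody.hausdorffDist_coe]
    refine Metric.hausdorffDist_le_of_mem_dist dist_nonneg (fun y hy => ?_) fun y hy => ?_
    · exact exists_dist_le_of_supportFunction_le K L dist_nonneg
        (fun x hx1 => by linarith [(abs_le.mp (hx x hx1)).2]) hy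
    · exact exists_dist_le_of_supportFunction_le L K dist_nonneg
        (fun x hx1 => by linarith [(abs_le.mp (hx x hx1)).1]) hy

/-! ### Support functions of zonotopes and zonoids -/

/-- The functions `x ↦ ⟨c, x⟩ + ∑ i, |⟨a i, x⟩|` on the unit sphere. -/
def zonotopeFunctions (n : ℕ) : Set C(Metric.sphere (0 : Rn n) 1, ℝ) :=
  {f | ∃ (k : ℕ) (c : Rn n) (a : Fin k → Rn n), ∀ x : Metric.sphere (0 : Rn n) 1,
    f x = inner ℝ c (x : Rn n) + ∑ i, |inner ℝ (a i) (x : Rn n)|}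

theorem inner_le_of_mem_segment {a b x y : Rn n} (hy : y ∈ segment ℝ a b) :
    inner ℝ x y ≤ inner ℝ ((1 / 2 : ℝ) • (a + b)) x + |inner ℝ ((1 / 2 : ℝ) • (b - a)) x| := by
  obtain ⟨s, t, hs, ht, hst, rfl⟩ := hy
  rw [real_inner_comm _ x]
  simp only [inner_add_left, inner_sub_left, real_inner_smul_left]
  have hs' : s = 1 - t := by linarith
  subst hs'
  have h1 := le_abs_self (1 / 2 * (inner ℝ b x - inner ℝ a x))
  have h2 := neg_abs_le (1 / 2 * (inner ℝ b x - inner ℝ a x))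
  nlinarith

theorem exists_mem_segment_inner_eq (a b x : Rn n) : ∃ y ∈ segment ℝ a b,
    inner ℝ x y = inner ℝ ((1 / 2 : ℝ) • (a + b)) x + |inner ℝ ((1 / 2 : ℝ) • (b - a)) x| := by
  simp only [inner_add_left, inner_sub_left, real_inner_smul_left]
  rcases le_total (inner ℝ a x) (inner ℝ b x) with h | h
  · refine ⟨b, right_mem_segment ℝ a b, ?_⟩
    rw [abs_of_nonneg (by linarith), real_inner_comm b x]
    ring
  · refine ⟨a, left_mem_segment ℝ a b, ?_⟩
    rw [abs_of_nonpos (by linarith), real_inner_comm a x]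
    ring

theorem supportFunction_of_eq_sum_segment {k : ℕ} {a b : Fin k → Rn n} {Z : ConvexBody (Rn n)}
    (hZ : (Z : Set (Rn n)) = ∑ i, segment ℝ (a i) (b i)) (x : Rn n) :
    supportFunction Z x = inner ℝ (∑ i, (1 / 2 : ℝ) • (a i + b i)) x +
      ∑ i, |inner ℝ ((1 / 2 : ℝ) • (b i - a i)) x| := by
  have hmem : ∀ y, y ∈ Z ↔ ∃ g : Fin k → Rn n,
      ∃ _ : ∀ i, g i ∈ segment ℝ (a i) (b i), ∑ i, g i = y := fun y => by
    rw [← SetLike.mem_coe, hZ, Set.mem_fintype_sum]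
  rw [sum_inner, ← Finset.sum_add_distrib]
  refine le_antisymm (supportFunction_le Z x fun y hy => ?_) ?_
  · obtain ⟨g, hg, rfl⟩ := (hmem y).mp hy
    rw [inner_sum]
    exact Finset.sum_le_sum fun i _ => inner_le_of_mem_segment (hg i)
  · choose g hg hgx using fun i => exists_mem_segment_inner_eq (a i) (b i) x
    rw [← Finset.sum_congr rfl fun i _ => hgx i, ← inner_sum]
    exact inner_le_supportFunction Z x ((hmem _).mpr ⟨g, hg, rfl⟩)

/-- A segment as a convex body. -/
def segmentBody (a b : Rn n) : ConvexBody (Rn n) where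
  carrier := segment ℝ a b
  convex' := convex_segment a b
  isCompact' := by
    rw [segment_eq_image]
    exact isCompact_Icc.image (by fun_prop)
  nonempty' := ⟨a, left_mem_segment ℝ a b⟩

theorem coe_sum_convexBody {k : ℕ} (B : Fin k → ConvexBody (Rn n)) :
    ((∑ i, B i : ConvexBody (Rn n)) : Set (Rn n)) = ∑ i, (B i : Set (Rn n)) :=
  map_sum (⟨⟨fun K : ConvexBody (Rn n) => (K : Set (Rn n)), ConvexBody.coe_zero⟩,
    ConvexBody.coe_add⟩ : ConvexBody (Rn n) →+ Set (Rn n)) B Finset.univ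

theorem image_supportOnSphere_zonotopes :
    supportOnSphere '' {Z : ConvexBody (Rn n) | IsZonotope Z} = zonotopeFunctions n := by
  ext f
  constructor
  · rintro ⟨Z, ⟨k, a, b, hZ⟩, rfl⟩
    exact ⟨k, _, _, fun x => supportFunction_of_eq_sum_segment hZ x⟩
  · rintro ⟨k, c, a, hf⟩
    -- The linear part is the degenerate segment `[c, c]`; each `|⟨a i, x⟩|` comes from `[-a i, a
    -- i]`.
    let p : Fin (k + 1) → Rn n := Fin.cons c fun i => -a i
    let q : Fin (k + 1) → Rn n := Fin.cons c a
    have hZ : ((∑ i, segmentBody (p i) (q i) : ConvexBody (Rn n)) : Set (Rn n)) =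
        ∑ i, segment ℝ (p i) (q i) := coe_sum_convexBody _
    refine ⟨_, ⟨k + 1, p, q, hZ⟩, ?_⟩
    ext x
    rw [hf, supportOnSphere_apply, supportFunction_of_eq_sum_segment hZ, Fin.sum_univ_succ,
      Fin.sum_univ_succ]
    have h2 : ∀ y : Rn n, (2⁻¹ : ℝ) • (y + y) = y := fun y => by
      rw [← two_smul ℝ y, smul_smul]
      norm_num
    simp [p, q, h2]

/-- An isometry induces the topology, so closures pull back without any need for its range to be
closed. -/
theorem isZonoid_iff (K : ConvexBody (Rn n)) :
    IsZonoid K ↔ supportOnSphere K ∈ closure (zonotopeFunctions n) := by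
  rw [IsZonoid, supportOnSphere_isometry.isUniformInducing.isInducing.closure_eq_preimage_closure_image,
    image_supportOnSphere_zonotopes, Set.mem_preimage]

theorem zonotopeFunctions_add_mem {f g : C(Metric.sphere (0 : Rn n) 1, ℝ)}
    (hf : f ∈ zonotopeFunctions n) (hg : g ∈ zonotopeFunctions n) :
    f + g ∈ zonotopeFunctions n := by
  obtain ⟨k, c, a, hf⟩ := hf
  obtain ⟨l, d, b, hg⟩ := hg
  refine ⟨k + l, c + d, Fin.append a b, fun x => ?_⟩
  simp only [ContinuousMap.add_apply, hf, hg, Fin.sum_univ_add, Fin.append_left, Fin.append_right,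
    inner_add_left]
  ring

theorem zonotopeFunctions_smul_mem {f : C(Metric.sphere (0 : Rn n) 1, ℝ)}
    (hf : f ∈ zonotopeFunctions n) {r : ℝ} (hr : 0 ≤ r) : r • f ∈ zonotopeFunctions n := by
  obtain ⟨k, c, a, hf⟩ := hf
  refine ⟨k, r • c, fun i => r • a i, fun x => ?_⟩
  simp only [ContinuousMap.smul_apply, hf, real_inner_smul_left, abs_mul, abs_of_nonneg hr,
    smul_eq_mul, mul_add, Finset.mul_sum]

theorem convex_zonotopeFunctions : Convex ℝ (zonotopeFunctions n) :=
  fun _ hf _ hg _ _ ha hb _ => zonotopeFunctions_add_mem (zonotopeFunctions_smul_mem hf ha)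
    (zonotopeFunctions_smul_mem hg hb)

theorem closure_zonotopeFunctions_add_mem {f g : C(Metric.sphere (0 : Rn n) 1, ℝ)}
    (hf : f ∈ closure (zonotopeFunctions n)) (hg : g ∈ closure (zonotopeFunctions n)) :
    f + g ∈ closure (zonotopeFunctions n) :=
  map_mem_closure₂ continuous_add hf hg fun _ ha _ hb => zonotopeFunctions_add_mem ha hb

theorem closure_zonotopeFunctions_smul_mem {f : C(Metric.sphere (0 : Rn n) 1, ℝ)}
    (hf : f ∈ closure (zonotopeFunctions n)) {r : ℝ} (hr : 0 ≤ r) :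
    r • f ∈ closure (zonotopeFunctions n) :=
  map_mem_closure (continuous_const_smul r) hf fun _ ha => zonotopeFunctions_smul_mem ha hr

/-- Averages of functions in the closed cone of zonoid support functions stay in it. -/
theorem mem_closure_zonotopeFunctions_of_integral {X : Type*} [TopologicalSpace X]
    [CompactSpace X] [MeasurableSpace X] [OpensMeasurableSpace X] [SecondCountableTopology X]
    (μ : Measure X) [IsProbabilityMeasure μ]
    (F : X → C(Metric.sphere (0 : Rn n) 1, ℝ)) (hF : Continuous F)
    (hmem : ∀ t, F t ∈ closure (zonotopeFunctions n)) {g : C(Metric.sphere (0 : Rn n) 1, ℝ)}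
    (hg : ∀ x, g x = ∫ t, F t x ∂μ) : g ∈ closure (zonotopeFunctions n) := by
  have hint : Integrable F μ :=
    hF.integrable_of_hasCompactSupport (HasCompactSupport.of_compactSpace _)
  have : g = ∫ t, F t ∂μ := by
    ext x
    rw [hg, ContinuousMap.integral_apply hint]
  rw [this]
  exact convex_zonotopeFunctions.closure.integral_mem isClosed_closure (.of_forall hmem) hint

/-! ### The transform kernel -/

/-- The constant `D` with `D * |a| = ∫ (1 - cos (τ a)) / τ ^ 2 dτ`. -/
def absConst : ℝ := ∫ τ : ℝ, (1 - Real.cos τ) / τ ^ 2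

theorem integrable_one_sub_cos_div_sq : Integrable fun τ : ℝ => (1 - Real.cos τ) / τ ^ 2 := by
  -- The constant is `1/2 + 2`: use `1 - cos τ ≤ τ ^ 2 / 2` for the summand `1` of `1 + τ ^ 2`, and
  -- `1 - cos τ ≤ 2` for `τ ^ 2`.
  refine (integrable_inv_one_add_sq.const_mul (5 / 2 : ℝ)).mono'
    (Measurable.aestronglyMeasurable (by fun_prop)) (.of_forall fun τ => ?_)
  have h1 := Real.one_sub_sq_div_two_le_cos (x := τ)
  have h2 := Real.cos_le_one τ
  have h3 := Real.neg_one_le_cos τ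
  rw [Real.norm_of_nonneg (div_nonneg (by linarith) (sq_nonneg τ))]
  rcases eq_or_ne τ 0 with rfl | hτ
  · norm_num
  · have : 0 < τ ^ 2 := by positivity
    rw [div_le_iff₀ this, ← div_eq_mul_inv, div_mul_eq_mul_div, le_div_iff₀ (by positivity)]
    nlinarith

/-- Prepares the substitution `σ = τ a`: the factor `a ^ 2` and the Jacobian `|a|⁻¹` combine to
`|a|`. -/
theorem one_sub_cos_mul_div_sq (a τ : ℝ) :
    (1 - Real.cos (τ * a)) / τ ^ 2 = a ^ 2 * ((1 - Real.cos (τ * a)) / (τ * a) ^ 2) := by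
  rcases eq_or_ne a 0 with rfl | ha
  · simp
  · rcases eq_or_ne τ 0 with rfl | hτ
    · simp
    · field_simp

theorem integrable_one_sub_cos_mul_div_sq (a : ℝ) :
    Integrable fun τ : ℝ => (1 - Real.cos (τ * a)) / τ ^ 2 := by
  rcases eq_or_ne a 0 with rfl | ha
  · simp
  · simp_rw [one_sub_cos_mul_div_sq a]
    exact (integrable_one_sub_cos_div_sq.comp_mul_right' ha).const_mul _

theorem integral_one_sub_cos_mul_div_sq (a : ℝ) :
    ∫ τ : ℝ, (1 - Real.cos (τ * a)) / τ ^ 2 = absConst * |a| := by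
  simp_rw [one_sub_cos_mul_div_sq a]
  rw [integral_const_mul,
    Measure.integral_comp_mul_right (fun σ : ℝ => (1 - Real.cos σ) / σ ^ 2) a, ← absConst,
    smul_eq_mul, ← sq_abs, abs_inv]
  rcases eq_or_ne a 0 with rfl | ha
  · simp
  · have := abs_pos.mpr ha
    field_simp

/-! ### Growth inequalities for the hyperbolic cosine -/

theorem cosh_sub_one (y : ℝ) : Real.cosh y - 1 = 2 * Real.sinh (y / 2) ^ 2 := by
  have h := Real.cosh_two_mul (y / 2)
  rw [mul_div_cancel₀ y two_ne_zero, Real.cosh_sq] at h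
  linarith

theorem cosh_sub_one_nonneg (y : ℝ) : 0 ≤ Real.cosh y - 1 := by
  linarith [Real.one_le_cosh y]

theorem cosh_sub_one_le (y : ℝ) : Real.cosh y - 1 ≤ y ^ 2 / 2 * Real.cosh y := by
  have key : ∀ w : ℝ, 0 ≤ w → Real.sinh w ≤ w * Real.cosh w := by
    intro w hw
    have hm : MonotoneOn (fun w : ℝ => w * Real.cosh w - Real.sinh w) (Set.Ici 0) := by
      refine monotoneOn_of_deriv_nonneg (convex_Ici 0) (by fun_prop) (by fun_prop) fun x hx => ?_
      rw [interior_Ici, Set.mem_Ioi] at hx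
      have hd : HasDerivAt (fun w : ℝ => w * Real.cosh w - Real.sinh w)
          (1 * Real.cosh x + x * Real.sinh x - Real.cosh x) x :=
        ((hasDerivAt_id x).mul (Real.hasDerivAt_cosh x)).sub (Real.hasDerivAt_sinh x)
      rw [hd.deriv]
      nlinarith [Real.sinh_nonneg_iff.mpr hx.le]
    have := hm (Set.mem_Ici.mpr le_rfl) hw hw
    simpa using this
  have h1 : Real.sinh (|y| / 2) ^ 2 ≤ (|y| / 2 * Real.cosh (|y| / 2)) ^ 2 :=
    pow_le_pow_left₀ (Real.sinh_nonneg_iff.mpr (by positivity)) (key _ (by positivity)) 2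
  have h2 : Real.cosh (|y| / 2) ^ 2 ≤ Real.cosh |y| := by
    have h := Real.cosh_two_mul (|y| / 2)
    rw [mul_div_cancel₀ _ two_ne_zero] at h
    nlinarith [sq_nonneg (Real.sinh (|y| / 2))]
  rw [← Real.cosh_abs, cosh_sub_one, ← sq_abs y]
  rw [mul_pow, div_pow] at h1
  nlinarith [mul_le_mul_of_nonneg_left h2 (sq_nonneg |y|)]

theorem sq_div_two_le_cosh_sub_one (y : ℝ) : y ^ 2 / 2 ≤ Real.cosh y - 1 := by
  rw [← Real.cosh_abs, cosh_sub_one, ← sq_abs]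
  have h : |y| / 2 ≤ Real.sinh (|y| / 2) := Real.self_le_sinh_iff.mpr (by positivity)
  nlinarith [pow_le_pow_left₀ (by positivity) h 2]

/-- This quadratic gain is the source of the concentration of `Q`. With `w = (1 - r) y / 2`, the
addition formula gives `sinh (y / 2) ≥ sinh (r y / 2) cosh w` for `y ≥ 0`; square it and use `cosh w
^ 2 ≥ 1 + w ^ 2`. -/
theorem cosh_mul_sub_one_le {r : ℝ} (hr0 : 0 ≤ r) (hr1 : r ≤ 1) (y : ℝ) :
    (1 + ((1 - r) / 2 * y) ^ 2) * (Real.cosh (r * y) - 1) ≤ Real.cosh y - 1 := by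
  have key : ∀ y : ℝ, 0 ≤ y →
      (1 + ((1 - r) / 2 * y) ^ 2) * (Real.cosh (r * y) - 1) ≤ Real.cosh y - 1 := by
    intro y hy
    set w := (1 - r) / 2 * y with hw
    have hw0 : 0 ≤ w := mul_nonneg (by linarith) hy
    have hs : 0 ≤ Real.sinh (r * y / 2) := Real.sinh_nonneg_iff.mpr (by positivity)
    have hadd : Real.sinh (y / 2) = Real.sinh (r * y / 2) * Real.cosh w +
        Real.cosh (r * y / 2) * Real.sinh w := by
      rw [← Real.sinh_add, hw]
      congr 1
      ring
    have hle : Real.sinh (r * y / 2) * Real.cosh w ≤ Real.sinh (y / 2) := by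
      rw [hadd]
      exact le_add_of_nonneg_right
        (mul_nonneg (Real.cosh_pos _).le (Real.sinh_nonneg_iff.mpr hw0))
    have hsq := pow_le_pow_left₀ (mul_nonneg hs (Real.cosh_pos w).le) hle 2
    have hc : 1 + w ^ 2 ≤ Real.cosh w ^ 2 := by
      rw [Real.cosh_sq]
      nlinarith [Real.self_le_sinh_iff.mpr hw0]
    rw [cosh_sub_one, cosh_sub_one]
    rw [mul_pow] at hsq
    nlinarith [mul_le_mul_of_nonneg_right hc (sq_nonneg (Real.sinh (r * y / 2)))]
  rcases le_total 0 y with hy | hy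
  · exact key y hy
  · have := key (-y) (by linarith)
    simpa using this

/-- `Q z = ∫ exp (-τ ^ 2 / 2) (cosh (τ z) - 1) / τ ^ 2 dτ`. -/
def coshKernel (z : ℝ) : ℝ :=
  ∫ τ : ℝ, Real.exp (-τ ^ 2 / 2) * ((Real.cosh (τ * z) - 1) / τ ^ 2)

theorem integrable_exp_neg_sq_div_two : Integrable fun τ : ℝ => Real.exp (-τ ^ 2 / 2) := by
  refine (integrable_exp_neg_mul_sq (b := 1 / 2) (by norm_num)).congr (.of_forall fun τ => ?_)
  simp only
  congr 1
  ring

theorem integrable_exp_neg_sq_mul_cosh (z : ℝ) :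
    Integrable fun τ : ℝ => Real.exp (-τ ^ 2 / 2) * Real.cosh (τ * z) := by
  have h : ∀ w : ℝ, Integrable fun τ : ℝ => Real.exp (-τ ^ 2 / 2) * Real.exp (τ * w) := by
    intro w
    -- Completing the square turns the integrand into a shifted Gaussian.
    refine ((integrable_exp_neg_sq_div_two.comp_sub_right w).const_mul
      (Real.exp (w ^ 2 / 2))).congr (.of_forall fun τ => ?_)
    simp only
    rw [← Real.exp_add, ← Real.exp_add]
    congr 1
    ring
  refine (((h z).add (h (-z))).div_const 2).congr (.of_forall fun τ => ?_)
  simp only [Pi.add_apply, Real.cosh_eq, mul_neg]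
  ring

theorem coshKernel_integrand_nonneg (z τ : ℝ) :
    0 ≤ Real.exp (-τ ^ 2 / 2) * ((Real.cosh (τ * z) - 1) / τ ^ 2) :=
  mul_nonneg (Real.exp_pos _).le (div_nonneg (cosh_sub_one_nonneg _) (sq_nonneg τ))

theorem integrable_coshKernel (z : ℝ) :
    Integrable fun τ : ℝ => Real.exp (-τ ^ 2 / 2) * ((Real.cosh (τ * z) - 1) / τ ^ 2) := by
  refine ((integrable_exp_neg_sq_mul_cosh z).const_mul (z ^ 2 / 2)).mono'
    (by fun_prop) (.of_forall fun τ => ?_)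
  rw [Real.norm_of_nonneg (coshKernel_integrand_nonneg z τ)]
  have h : (Real.cosh (τ * z) - 1) / τ ^ 2 ≤ z ^ 2 / 2 * Real.cosh (τ * z) := by
    refine div_le_of_le_mul₀ (sq_nonneg τ) (by positivity) ((cosh_sub_one_le _).trans_eq ?_)
    ring
  calc _ ≤ Real.exp (-τ ^ 2 / 2) * (z ^ 2 / 2 * Real.cosh (τ * z)) :=
        mul_le_mul_of_nonneg_left h (Real.exp_pos _).le
    _ = _ := by ring

theorem coshKernel_nonneg (z : ℝ) : 0 ≤ coshKernel z :=
  integral_nonneg fun τ => coshKernel_integrand_nonneg z τ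

theorem coshKernel_integrand_mono {z w : ℝ} (h : |z| ≤ |w|) (τ : ℝ) :
    Real.exp (-τ ^ 2 / 2) * ((Real.cosh (τ * z) - 1) / τ ^ 2) ≤
      Real.exp (-τ ^ 2 / 2) * ((Real.cosh (τ * w) - 1) / τ ^ 2) := by
  have h1 : Real.cosh (τ * z) ≤ Real.cosh (τ * w) := by
    rw [Real.cosh_le_cosh, abs_mul, abs_mul]
    exact mul_le_mul_of_nonneg_left h (abs_nonneg τ)
  gcongr

theorem coshKernel_mono {z w : ℝ} (h : |z| ≤ |w|) : coshKernel z ≤ coshKernel w :=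
  integral_mono (integrable_coshKernel z) (integrable_coshKernel w)
    (coshKernel_integrand_mono h)

theorem continuous_coshKernel : Continuous coshKernel := by
  refine continuous_iff_continuousAt.mpr fun z => ?_
  refine continuousAt_of_dominated (F := fun z τ : ℝ =>
      Real.exp (-τ ^ 2 / 2) * ((Real.cosh (τ * z) - 1) / τ ^ 2))
    (bound := fun τ => Real.exp (-τ ^ 2 / 2) * ((Real.cosh (τ * (|z| + 1)) - 1) / τ ^ 2))
    (.of_forall fun w => (integrable_coshKernel w).aestronglyMeasurable) ?_
    (integrable_coshKernel _) (.of_forall fun τ => by fun_prop)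
  have : ∀ᶠ w in nhds z, |w| < |z| + 1 :=
    continuous_abs.continuousAt.eventually_lt continuousAt_const (by linarith)
  filter_upwards [this] with w hw
  refine .of_forall fun τ => ?_
  rw [Real.norm_of_nonneg (coshKernel_integrand_nonneg w τ)]
  exact coshKernel_integrand_mono (hw.le.trans (le_abs_self _)) τ

/-- Quartic growth is what later absorbs a quadratic error term. The gain inequality with `r = 1/2`
gives `cosh y - 1 ≥ (y ^ 2 / 16) (y ^ 2 / 8) = y ^ 4 / 128`, applied at `y = τ z`. -/
theorem exists_coshKernel_ge : ∃ c : ℝ, 0 < c ∧ ∀ z, c * z ^ 4 ≤ coshKernel z := by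
  set I := ∫ τ : ℝ, Real.exp (-τ ^ 2 / 2) * τ ^ 2 with hI
  have hint : Integrable fun τ : ℝ => Real.exp (-τ ^ 2 / 2) * τ ^ 2 := by
    refine ((integrable_exp_neg_sq_mul_cosh 1).const_mul 2).mono' (by fun_prop)
      (.of_forall fun τ => ?_)
    rw [Real.norm_of_nonneg (by positivity), mul_one]
    nlinarith [mul_le_mul_of_nonneg_left (sq_div_two_le_cosh_sub_one τ)
      (Real.exp_pos (-τ ^ 2 / 2)).le, Real.exp_pos (-τ ^ 2 / 2)]
  have hIpos : 0 < I := by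
    refine integral_pos_of_integrable_nonneg_nonzero (x := 1) (by fun_prop) hint
      (fun τ => by positivity) ?_
    positivity
  refine ⟨I / 128, by positivity, fun z => ?_⟩
  have : I / 128 * z ^ 4 = ∫ τ : ℝ, z ^ 4 / 128 * (Real.exp (-τ ^ 2 / 2) * τ ^ 2) := by
    rw [integral_const_mul, ← hI]
    ring
  rw [this]
  refine integral_mono (hint.const_mul _) (integrable_coshKernel z) fun τ => ?_
  have h1 := cosh_mul_sub_one_le (r := 1 / 2) (by norm_num) (by norm_num) (τ * z)
  have h2 := sq_div_two_le_cosh_sub_one (1 / 2 * (τ * z))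
  have h3 : z ^ 4 / 128 * τ ^ 2 ≤ (Real.cosh (τ * z) - 1) / τ ^ 2 := by
    rcases eq_or_ne τ 0 with rfl | hτ
    · simp
    · rw [le_div_iff₀ (by positivity)]
      have h4 := mul_le_mul_of_nonneg_left h2
        (show 0 ≤ 1 + ((1 - 1 / 2) / 2 * (τ * z)) ^ 2 by positivity)
      nlinarith [sq_nonneg (τ * z)]
  calc z ^ 4 / 128 * (Real.exp (-τ ^ 2 / 2) * τ ^ 2)
      = Real.exp (-τ ^ 2 / 2) * (z ^ 4 / 128 * τ ^ 2) := by ring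
    _ ≤ _ := mul_le_mul_of_nonneg_left h3 (Real.exp_pos _).le

/-- For large `|y|` the gain `(κ y) ^ 2` is at least `1 / δ`; for small `|y|` the left side is at
most a multiple of `y ^ 2`. The threshold `Y` solves `δ (κ Y) ^ 2 = 1`. -/
theorem exists_cosh_mul_sub_one_le {r : ℝ} (hr0 : 0 ≤ r) (hr1 : r < 1) {δ : ℝ} (hδ : 0 < δ) :
    ∃ M : ℝ, 0 ≤ M ∧ ∀ y : ℝ,
      Real.cosh (r * y) - 1 ≤ δ * (Real.cosh y - 1) + M * y ^ 2 := by
  set κ := (1 - r) / 2 with hκ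
  have hκ0 : 0 < κ := by linarith
  set Y := (κ * Real.sqrt δ)⁻¹ with hY
  have hY0 : 0 < Y := by positivity
  refine ⟨Real.cosh Y / 2, by positivity, fun y => ?_⟩
  have h := cosh_mul_sub_one_le hr0 hr1.le y
  rw [← hκ] at h
  have hn := cosh_sub_one_nonneg (r * y)
  have hn' := cosh_sub_one_nonneg y
  rcases le_total |y| Y with hy | hy
  · have h1 : Real.cosh (r * y) - 1 ≤ Real.cosh y - 1 :=
      le_trans (by nlinarith [sq_nonneg (κ * y)]) h
    have h2 : Real.cosh y ≤ Real.cosh Y := by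
      rw [Real.cosh_le_cosh, abs_of_pos hY0]
      exact hy
    have h3 := cosh_sub_one_le y
    nlinarith [mul_le_mul_of_nonneg_left h2 (sq_nonneg y), mul_nonneg hδ.le hn']
  · have h1 : 1 ≤ δ * (κ * y) ^ 2 := by
      have h2 : δ * (κ * Y) ^ 2 = 1 := by
        rw [hY, mul_inv, mul_inv_cancel_left₀ hκ0.ne', inv_pow, Real.sq_sqrt hδ.le,
          mul_inv_cancel₀ hδ.ne']
      rw [← h2, mul_pow, mul_pow, ← sq_abs y]
      gcongr
    have h3 : Real.cosh (r * y) - 1 ≤ δ * (Real.cosh y - 1) := by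
      have h4 := mul_le_mul_of_nonneg_left h hδ.le
      nlinarith [mul_le_mul_of_nonneg_right h1 hn, mul_nonneg hδ.le hn]
    have : 0 ≤ Real.cosh Y / 2 * y ^ 2 := by positivity
    linarith

/-- The kernel `t ↦ Q (s t)` concentrates at `|t| = 1` as `s → ∞`. -/
theorem coshKernel_concentration {a b : ℝ} (hb : 0 ≤ b) (hab : b < a) {δ : ℝ} (hδ : 0 < δ) :
    ∃ s : ℝ, 0 < s ∧ coshKernel (s * b) ≤ δ * coshKernel (s * a) := by
  have ha : 0 < a := hb.trans_lt hab
  -- Half of `δ` is spent here; the other half absorbs the error `M * J * z ^ 2` through the quartic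
  -- lower bound.
  obtain ⟨M, hM0, hM⟩ := exists_cosh_mul_sub_one_le (r := b / a) (by positivity)
    ((div_lt_one ha).mpr hab) (half_pos hδ)
  obtain ⟨c, hc0, hc⟩ := exists_coshKernel_ge
  set J := ∫ τ : ℝ, Real.exp (-τ ^ 2 / 2) with hJ
  have hJ0 : 0 ≤ J := integral_nonneg fun τ => (Real.exp_pos _).le
  have key : ∀ z, coshKernel (b / a * z) ≤ δ / 2 * coshKernel z + M * J * z ^ 2 := by
    intro z
    have : δ / 2 * coshKernel z + M * J * z ^ 2 = ∫ τ : ℝ,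
        (δ / 2 * (Real.exp (-τ ^ 2 / 2) * ((Real.cosh (τ * z) - 1) / τ ^ 2)) +
          M * z ^ 2 * Real.exp (-τ ^ 2 / 2)) := by
      rw [integral_add ((integrable_coshKernel z).const_mul _)
        (integrable_exp_neg_sq_div_two.const_mul _), integral_const_mul, integral_const_mul,
        ← hJ, coshKernel]
      ring
    rw [this]
    refine integral_mono (integrable_coshKernel _) (((integrable_coshKernel z).const_mul _).add
      (integrable_exp_neg_sq_div_two.const_mul _)) fun τ => ?_
    have h1 : (Real.cosh (τ * (b / a * z)) - 1) / τ ^ 2 ≤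
        δ / 2 * ((Real.cosh (τ * z) - 1) / τ ^ 2) + M * z ^ 2 := by
      have h2 := hM (τ * z)
      rw [show b / a * (τ * z) = τ * (b / a * z) by ring] at h2
      rcases eq_or_ne τ 0 with rfl | hτ
      · simp
        positivity
      · have : 0 < τ ^ 2 := by positivity
        rw [div_le_iff₀ this]
        refine h2.trans_eq ?_
        field_simp
    calc _ ≤ Real.exp (-τ ^ 2 / 2) * (δ / 2 * ((Real.cosh (τ * z) - 1) / τ ^ 2) + M * z ^ 2) :=
          mul_le_mul_of_nonneg_left h1 (Real.exp_pos _).le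
      _ = _ := by ring
  obtain ⟨z, hz0, hz⟩ : ∃ z : ℝ, 0 < z ∧ M * J ≤ δ / 2 * c * z ^ 2 := by
    -- With `q` the quotient, `(q + 1) ^ 2 ≥ q` makes `q + 1` a witness without square roots.
    refine ⟨M * J / (δ / 2 * c) + 1, by positivity, ?_⟩
    have hp : 0 < δ / 2 * c := by positivity
    set q := M * J / (δ / 2 * c) with hq
    have hq0 : 0 ≤ q := by positivity
    have : M * J = δ / 2 * c * q := by rw [hq]; field_simp
    rw [this]
    exact mul_le_mul_of_nonneg_left (by nlinarith) hp.le
  refine ⟨z / a, by positivity, ?_⟩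
  have e1 : z / a * b = b / a * z := by ring
  have e2 : z / a * a = z := by field_simp
  rw [e1, e2]
  have h1 := key z
  have h2 := mul_le_mul_of_nonneg_left (hc z) (half_pos hδ).le
  have h3 := mul_le_mul_of_nonneg_right hz (sq_nonneg z)
  nlinarith

/-! ### Gaussian integrals -/

/-- The function `y ↦ 1 - exp (s ^ 2 / 2) cos (s y)`. -/
def cosWeight (s y : ℝ) : ℝ := 1 - Real.exp (s ^ 2 / 2) * Real.cos (s * y)

theorem continuous_cosWeight (s : ℝ) : Continuous (cosWeight s) := by
  unfold cosWeight
  fun_prop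

theorem cosWeight_neg (s y : ℝ) : cosWeight s (-y) = cosWeight s y := by
  simp [cosWeight]

theorem abs_cosWeight_le (s y : ℝ) : |cosWeight s y| ≤ 1 + Real.exp (s ^ 2 / 2) := by
  have h := Real.abs_cos_le_one (s * y)
  have he := Real.exp_pos (s ^ 2 / 2)
  calc |cosWeight s y| ≤ |1| + |Real.exp (s ^ 2 / 2) * Real.cos (s * y)| := abs_sub _ _
    _ ≤ 1 + Real.exp (s ^ 2 / 2) := by
      rw [abs_one, abs_mul, abs_of_pos he]
      nlinarith

/-- The standard Gaussian measure on `ℝⁿ`. -/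
abbrev gaussian (n : ℕ) : Measure (Rn n) := ProbabilityTheory.stdGaussian (Rn n)

theorem integrable_norm_gaussian : Integrable (fun v : Rn n => ‖v‖) (gaussian n) :=
  (ProbabilityTheory.IsGaussian.integrable_id (μ := gaussian n)).norm

theorem integrable_cos_inner (w : Rn n) :
    Integrable (fun v : Rn n => Real.cos (inner ℝ w v)) (gaussian n) :=
  (integrable_const (1 : ℝ)).mono' (Continuous.aestronglyMeasurable (by fun_prop))
    (.of_forall fun v => Real.abs_cos_le_one _)

/-- Real part of the Gaussian characteristic function. -/
theorem integral_cos_inner (w : Rn n) :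
    ∫ v, Real.cos (inner ℝ w v) ∂(gaussian n) = Real.exp (-‖w‖ ^ 2 / 2) := by
  have h := ProbabilityTheory.charFun_stdGaussian (E := Rn n) w
  rw [charFun_apply] at h
  have hint : Integrable (fun v : Rn n => Complex.exp ((inner ℝ v w : ℝ) * Complex.I))
      (gaussian n) := by
    refine (integrable_const (1 : ℝ)).mono' (Continuous.aestronglyMeasurable (by fun_prop))
      (.of_forall fun v => ?_)
    rw [Complex.norm_exp_ofReal_mul_I]
  have h2 := congrArg Complex.re h
  have h3 : (∫ v, Complex.exp ((inner ℝ v w : ℝ) * Complex.I) ∂(gaussian n)).re =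
      ∫ v, (Complex.exp ((inner ℝ v w : ℝ) * Complex.I)).re ∂(gaussian n) :=
    (integral_re hint).symm
  rw [h3] at h2
  simp only [Complex.exp_ofReal_mul_I_re] at h2
  simp_rw [real_inner_comm _ w]
  rw [h2]
  rw [show (-(‖w‖ : ℂ) ^ 2 / 2) = ((-‖w‖ ^ 2 / 2 : ℝ) : ℂ) by push_cast; ring,
    Complex.exp_ofReal_re]

/-- Expand into cosines. The factor `exp (s ^ 2 / 2)` in the weight is chosen so that the mean of
its cosine term is exactly `1` and cancels the constant; the product of cosines yields the `cosh`.
-/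
theorem integral_one_sub_cos_mul_cosWeight {x u : Rn n} (hx : ‖x‖ = 1) (hu : ‖u‖ = 1)
    (s τ : ℝ) :
    ∫ v, (1 - Real.cos (τ * inner ℝ x v)) * cosWeight s (inner ℝ u v) ∂(gaussian n) =
      Real.exp (-τ ^ 2 / 2) * (Real.cosh (τ * (s * inner ℝ x u)) - 1) := by
  set E := Real.exp (s ^ 2 / 2) with hE
  have hpt : ∀ v : Rn n, (1 - Real.cos (τ * inner ℝ x v)) * cosWeight s (inner ℝ u v) =
      1 - Real.cos (inner ℝ (τ • x) v) - E * Real.cos (inner ℝ (s • u) v) +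
        E / 2 * (Real.cos (inner ℝ (τ • x + s • u) v) + Real.cos (inner ℝ (τ • x - s • u) v)) := by
    intro v
    rw [cosWeight, inner_add_left, inner_sub_left, real_inner_smul_left, real_inner_smul_left,
      Real.cos_add, Real.cos_sub]
    ring
  simp_rw [hpt]
  have i1 := integrable_cos_inner (τ • x)
  have i2 := (integrable_cos_inner (s • u)).const_mul E
  have i3 := integrable_cos_inner (τ • x + s • u)
  have i4 := integrable_cos_inner (τ • x - s • u)
  have i0 : Integrable (fun _ : Rn n => (1 : ℝ)) (gaussian n) := integrable_const 1
  rw [integral_add (f := fun v => 1 - Real.cos (inner ℝ (τ • x) v) -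
        E * Real.cos (inner ℝ (s • u) v))
      (g := fun v => E / 2 * (Real.cos (inner ℝ (τ • x + s • u) v) +
        Real.cos (inner ℝ (τ • x - s • u) v))) ((i0.sub i1).sub i2) ((i3.add i4).const_mul _),
    integral_sub (f := fun v => 1 - Real.cos (inner ℝ (τ • x) v)) (i0.sub i1) i2,
    integral_sub i0 i1, integral_const_mul, integral_const_mul, integral_add i3 i4]
  simp only [integral_cos_inner]
  have n1 : ‖τ • x‖ ^ 2 = τ ^ 2 := by rw [norm_smul, hx, mul_one, Real.norm_eq_abs, sq_abs]
  have n2 : ‖s • u‖ ^ 2 = s ^ 2 := by rw [norm_smul, hu, mul_one, Real.norm_eq_abs, sq_abs]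
  have n3 : inner ℝ (τ • x) (s • u) = τ * (s * inner ℝ x u) := by
    rw [real_inner_smul_left, real_inner_smul_right]
  rw [norm_add_sq_real, norm_sub_sq_real, n1, n2, n3, Real.cosh_eq, hE]
  set p := τ * (s * inner ℝ x u) with hp
  have e1 : Real.exp (s ^ 2 / 2) * Real.exp (-s ^ 2 / 2) = 1 := by
    rw [← Real.exp_add, ← Real.exp_zero]
    congr 1
    ring
  have e2 : Real.exp (s ^ 2 / 2) * Real.exp (-(τ ^ 2 + 2 * p + s ^ 2) / 2) =
      Real.exp (-τ ^ 2 / 2) * Real.exp (-p) := by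
    rw [← Real.exp_add, ← Real.exp_add]
    congr 1
    ring
  have e3 : Real.exp (s ^ 2 / 2) * Real.exp (-(τ ^ 2 - 2 * p + s ^ 2) / 2) =
      Real.exp (-τ ^ 2 / 2) * Real.exp p := by
    rw [← Real.exp_add, ← Real.exp_add]
    congr 1
    ring
  simp only [integral_const, probReal_univ, smul_eq_mul, mul_one]
  linear_combination -e1 + e2 / 2 + e3 / 2

theorem integrable_abs_inner_mul_cosWeight (x u : Rn n) (s : ℝ) :
    Integrable (fun v : Rn n => |inner ℝ x v| * cosWeight s (inner ℝ u v)) (gaussian n) := by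
  have hc := continuous_cosWeight s
  refine (integrable_norm_gaussian.const_mul (‖x‖ * (1 + Real.exp (s ^ 2 / 2)))).mono'
    (Continuous.aestronglyMeasurable (by fun_prop)) (.of_forall fun v => ?_)
  rw [norm_mul, Real.norm_eq_abs, Real.norm_eq_abs, abs_abs]
  calc |inner ℝ x v| * |cosWeight s (inner ℝ u v)|
      ≤ (‖x‖ * ‖v‖) * (1 + Real.exp (s ^ 2 / 2)) :=
        mul_le_mul (abs_real_inner_le_norm x v) (abs_cosWeight_le _ _) (abs_nonneg _)
          (by positivity)
    _ = _ := by ring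

/-- Write `absConst * |⟨x, v⟩|` as an integral over `τ` and exchange it with the Gaussian integral.
Keeping `absConst` as a factor avoids any need for its value. -/
theorem integral_abs_inner_mul_cosWeight {x u : Rn n} (hx : ‖x‖ = 1) (hu : ‖u‖ = 1) (s : ℝ) :
    absConst * ∫ v, |inner ℝ x v| * cosWeight s (inner ℝ u v) ∂(gaussian n) =
      coshKernel (s * inner ℝ x u) := by
  set F : Rn n → ℝ → ℝ := fun v τ =>
    (1 - Real.cos (τ * inner ℝ x v)) / τ ^ 2 * cosWeight s (inner ℝ u v) with hF
  have hFint : ∀ v, Integrable (F v) := fun v =>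
    (integrable_one_sub_cos_mul_div_sq _).mul_const _
  have hFnorm : ∀ v, ∫ τ, ‖F v τ‖ = absConst * |inner ℝ x v| * |cosWeight s (inner ℝ u v)| := by
    intro v
    rw [← integral_one_sub_cos_mul_div_sq, ← integral_mul_const]
    refine integral_congr_ae (.of_forall fun τ => ?_)
    simp only [hF]
    rw [norm_mul, Real.norm_of_nonneg, Real.norm_eq_abs]
    exact div_nonneg (by linarith [Real.cos_le_one (τ * inner ℝ x v)]) (sq_nonneg τ)
  have hmeas : Measurable (Function.uncurry F) := by
    have hc := (continuous_cosWeight s).measurable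
    simp only [hF, Function.uncurry_def]
    fun_prop
  have hprod : Integrable (Function.uncurry F) ((gaussian n).prod volume) := by
    rw [integrable_prod_iff hmeas.aestronglyMeasurable]
    refine ⟨.of_forall hFint, ?_⟩
    simp only [Function.uncurry_apply_pair, hFnorm]
    refine ((integrable_abs_inner_mul_cosWeight x u s).norm.const_mul absConst).congr
      (.of_forall fun v => ?_)
    simp only [norm_mul, Real.norm_eq_abs, abs_abs]
    ring
  calc absConst * ∫ v, |inner ℝ x v| * cosWeight s (inner ℝ u v) ∂(gaussian n)
      = ∫ v, (∫ τ, F v τ) ∂(gaussian n) := by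
        rw [← integral_const_mul]
        refine integral_congr_ae (.of_forall fun v => ?_)
        simp only [hF]
        rw [integral_mul_const, integral_one_sub_cos_mul_div_sq]
        ring
    _ = ∫ τ, ∫ v, F v τ ∂(gaussian n) := integral_integral_swap hprod
    _ = coshKernel (s * inner ℝ x u) := by
        refine integral_congr_ae (.of_forall fun τ => ?_)
        simp only [hF]
        simp_rw [div_mul_eq_mul_div]
        rw [integral_div, integral_one_sub_cos_mul_cosWeight hx hu]
        ring

/-! ### The orthogonal group -/

/-- The normalized Haar measure on the orthogonal group. -/
def haarOrth (n : ℕ) : Measure (OrthGroup n) := Measure.haarMeasure ⊤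

instance haarOrth_isProbabilityMeasure : IsProbabilityMeasure (haarOrth n) :=
  ⟨by simpa [haarOrth] using
    Measure.haarMeasure_self (K₀ := (⊤ : TopologicalSpace.PositiveCompacts (OrthGroup n)))⟩

instance haarOrth_isHaarMeasure : (haarOrth n).IsHaarMeasure := by
  unfold haarOrth
  infer_instance

/-- Compact groups are unimodular: a right translate of the Haar probability measure is again one,
and such a measure is unique. -/
instance haarOrth_isMulRightInvariant : (haarOrth n).IsMulRightInvariant where
  map_mul_right_eq_self g := by
    have : IsProbabilityMeasure ((haarOrth n).map (· * g)) :=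
      Measure.isProbabilityMeasure_map (by fun_prop)
    exact Measure.isHaarMeasure_eq_of_isProbabilityMeasure _ _

/-- The action of the orthogonal group on `ℝⁿ`. -/
abbrev orthApply (T : OrthGroup n) (x : Rn n) : Rn n := (T : Rn n →L[ℝ] Rn n) x

theorem continuous_orthApply :
    Continuous fun p : OrthGroup n × Rn n => orthApply p.1 p.2 :=
  (continuous_subtype_val.comp continuous_fst).clm_apply continuous_snd

theorem inner_orthApply (T : OrthGroup n) (x y : Rn n) :
    inner ℝ (orthApply T x) (orthApply T y) = inner ℝ x y :=
  ContinuousLinearMap.inner_map_map_of_mem_unitary T.2 x y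

theorem exists_orthApply_eq {x y : Rn n} (h : ‖x‖ = ‖y‖) : ∃ T : OrthGroup n, orthApply T x = y := by
  refine ⟨Unitary.linearIsometryEquiv.symm ((ℝ ∙ (x - y))ᗮ.reflection), ?_⟩
  rw [orthApply, Unitary.coe_symm_linearIsometryEquiv_apply]
  exact Submodule.reflection_sub h

theorem integral_gaussian_orthApply (T : OrthGroup n) (f : Rn n → ℝ) :
    ∫ v, f (orthApply T v) ∂(gaussian n) = ∫ v, f v ∂(gaussian n) := by
  have h := ProbabilityTheory.stdGaussian_map (Unitary.linearIsometryEquiv T)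
  conv_rhs => rw [gaussian, ← h]
  exact ((Unitary.linearIsometryEquiv T).toHomeomorph.isClosedEmbedding.measurableEmbedding.integral_map
    f).symm

theorem integrable_orth_prod_gaussian {F : OrthGroup n → Rn n → ℝ}
    (hF : Continuous (Function.uncurry F)) {C : ℝ} (hC : ∀ T v, |F T v| ≤ C * ‖v‖) :
    Integrable (Function.uncurry F) ((haarOrth n).prod (gaussian n)) := by
  have h : Integrable (fun p : OrthGroup n × Rn n => C * ‖p.2‖)
      ((haarOrth n).prod (gaussian n)) :=
    (integrable_norm_gaussian.comp_snd (haarOrth n)).const_mul C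
  exact h.mono' hF.aestronglyMeasurable (.of_forall fun p => hC p.1 p.2)

/-- Polar decomposition of the Gaussian measure. -/
theorem integral_gaussian_eq_integral_orth {e : Rn n} (he : ‖e‖ = 1) {f : Rn n → ℝ}
    (hf : Continuous f) {C : ℝ} (hC : ∀ v, |f v| ≤ C * ‖v‖) :
    ∫ v, f v ∂(gaussian n) =
      ∫ T, ∫ v, f (‖v‖ • orthApply T e) ∂(gaussian n) ∂(haarOrth n) := by
  have hact := continuous_orthApply (n := n)
  -- Some rotation `S` carries `‖v‖ • e` to `v`, and right invariance absorbs `S`.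
  have hpolar : ∀ v : Rn n, ∫ T, f (orthApply T v) ∂(haarOrth n) =
      ∫ T, f (‖v‖ • orthApply T e) ∂(haarOrth n) := by
    intro v
    obtain ⟨S, hS⟩ := exists_orthApply_eq (x := ‖v‖ • e) (y := v) (by simp [norm_smul, he])
    have h := integral_mul_right_eq_self (μ := haarOrth n)
      (fun T => f (orthApply T (‖v‖ • e))) S
    simp only [orthApply, Submonoid.coe_mul, mul_apply_eq_comp] at h hS
    simp only [hS] at h
    simpa only [orthApply, map_smul] using h
  calc ∫ v, f v ∂(gaussian n)
      = ∫ T, ∫ v, f (orthApply T v) ∂(gaussian n) ∂(haarOrth n) := by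
        simp [integral_gaussian_orthApply]
    _ = ∫ v, ∫ T, f (orthApply T v) ∂(haarOrth n) ∂(gaussian n) := by
        refine integral_integral_swap (integrable_orth_prod_gaussian (hf.comp hact) (C := C)
          fun T v => ?_)
        rw [← orthGroup_norm_apply T v]
        exact hC _
    _ = ∫ v, ∫ T, f (‖v‖ • orthApply T e) ∂(haarOrth n) ∂(gaussian n) := by
        simp_rw [hpolar]
    _ = _ := by
        refine (integral_integral_swap (integrable_orth_prod_gaussian (C := C) ?_
          fun T v => ?_)).symm
        · exact hf.comp (continuous_snd.norm.smul
            (hact.comp (continuous_fst.prodMk continuous_const)))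
        · refine (hC _).trans_eq ?_
          rw [norm_smul, norm_norm, orthGroup_norm_apply, he, mul_one]

/-- The zonal kernel on the sphere whose cosine transform is `t ↦ Q (s t)`. -/
def zonalKernel (n : ℕ) (s t : ℝ) : ℝ :=
  absConst * ∫ v : Rn n, ‖v‖ * cosWeight s (‖v‖ * t) ∂(gaussian n)

theorem continuous_zonalKernel (s : ℝ) : Continuous (zonalKernel n s) := by
  have hc := continuous_cosWeight s
  refine continuous_const.mul (continuous_of_dominated
    (bound := fun v => ‖v‖ * (1 + Real.exp (s ^ 2 / 2)))
    (fun t => Continuous.aestronglyMeasurable (by fun_prop)) (fun t => .of_forall fun v => ?_)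
    (integrable_norm_gaussian.mul_const _) (.of_forall fun v => by fun_prop))
  rw [norm_mul, norm_norm]
  exact mul_le_mul_of_nonneg_left (abs_cosWeight_le _ _) (norm_nonneg v)

theorem zonalKernel_neg (s t : ℝ) : zonalKernel n s (-t) = zonalKernel n s t := by
  simp [zonalKernel, cosWeight_neg]

/-- In polar coordinates the homogeneity of `|⟨x, ·⟩|` pulls out a factor `‖v‖`; the remaining
radial integral is `zonalKernel`. -/
theorem integral_abs_inner_mul_zonalKernel {e x u : Rn n} (he : ‖e‖ = 1) (hx : ‖x‖ = 1)
    (hu : ‖u‖ = 1) (s : ℝ) :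
    ∫ T, |inner ℝ x (orthApply T e)| * zonalKernel n s (inner ℝ u (orthApply T e)) ∂(haarOrth n) =
      coshKernel (s * inner ℝ x u) := by
  have hc := continuous_cosWeight s
  rw [← integral_abs_inner_mul_cosWeight hx hu, integral_gaussian_eq_integral_orth he
    (f := fun v => |inner ℝ x v| * cosWeight s (inner ℝ u v))
    (C := 1 + Real.exp (s ^ 2 / 2)) (by fun_prop) (fun v => ?_), ← integral_const_mul]
  · refine integral_congr_ae (.of_forall fun T => ?_)
    simp only [zonalKernel, real_inner_smul_right, abs_mul, abs_norm]
    rw [mul_left_comm, ← integral_const_mul]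
    congr 2
    ext v
    ring
  · rw [abs_mul, abs_abs, mul_comm]
    refine mul_le_mul (abs_cosWeight_le _ _) ?_ (abs_nonneg _) (by positivity)
    simpa [hx] using abs_real_inner_le_norm x v

/-! ### Spins of zonoids are zonoids -/

/-- The action of an orthogonal transformation on the unit sphere. -/
def orthSphere (T : OrthGroup n) (x : Metric.sphere (0 : Rn n) 1) : Metric.sphere (0 : Rn n) 1 :=
  ⟨orthApply T x, by
    rw [mem_sphere_zero_iff_norm, orthGroup_norm_apply]
    exact mem_sphere_zero_iff_norm.mp x.2⟩

@[simp]
theorem coe_orthSphere (T : OrthGroup n) (x : Metric.sphere (0 : Rn n) 1) :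
    (orthSphere T x : Rn n) = orthApply T x := rfl

theorem continuous_orthSphere : Continuous fun p : OrthGroup n × Metric.sphere (0 : Rn n) 1 =>
    orthSphere p.1 p.2 :=
  (continuous_orthApply.comp (continuous_fst.prodMk
    (continuous_subtype_val.comp continuous_snd))).subtype_mk _

/-- Rotation of a function on the unit sphere. -/
def rotate (f : C(Metric.sphere (0 : Rn n) 1, ℝ)) (T : OrthGroup n) :
    C(Metric.sphere (0 : Rn n) 1, ℝ) :=
  f.comp ⟨orthSphere T, continuous_orthSphere.comp (continuous_const.prodMk continuous_id)⟩

@[simp]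
theorem rotate_apply (f : C(Metric.sphere (0 : Rn n) 1, ℝ)) (T : OrthGroup n)
    (x : Metric.sphere (0 : Rn n) 1) : rotate f T x = f (orthSphere T x) := rfl

theorem continuous_rotate (f : C(Metric.sphere (0 : Rn n) 1, ℝ)) : Continuous (rotate f) :=
  ContinuousMap.continuous_of_continuous_uncurry _ (f.continuous.comp continuous_orthSphere)

theorem rotate_mem_closure {f : C(Metric.sphere (0 : Rn n) 1, ℝ)}
    (hf : f ∈ closure (zonotopeFunctions n)) (T : OrthGroup n) :
    rotate f T ∈ closure (zonotopeFunctions n) := by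
  refine map_mem_closure (f := fun g => rotate g T) (ContinuousMap.continuous_precomp _) hf ?_
  rintro g ⟨k, c, a, hg⟩
  refine ⟨k, (T : Rn n →L[ℝ] Rn n).adjoint c, fun i => (T : Rn n →L[ℝ] Rn n).adjoint (a i),
    fun x => ?_⟩
  simp only [rotate_apply, hg, coe_orthSphere, orthApply, ContinuousLinearMap.adjoint_inner_left]

/-- The easy direction: the support function of the spin is an average over `O(u)` of rotates, all
lying in the closed convex cone. -/
theorem IsZonoid.spin {K : ConvexBody (Rn n)} (hK : IsZonoid K) (u : Rn n) :
    IsZonoid (spin u K) := by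
  rw [isZonoid_iff] at hK ⊢
  refine mem_closure_zonotopeFunctions_of_integral (haarO u)
    (fun T => rotate (supportOnSphere K) (T : OrthGroup n))
    ((continuous_rotate _).comp continuous_subtype_val)
    (fun T => rotate_mem_closure hK _) fun x => ?_
  rw [supportOnSphere_apply, supportFunction_spin]
  rfl

/-! ### Zonal averages of support functions -/

/-- The zonal average `u ↦ ∫ f (T e) k (⟨u, T e⟩) dT`. -/
def zonalAverage (s : ℝ) (e : Rn n) (f : Rn n → ℝ) (u : Rn n) : ℝ :=
  ∫ T, f (orthApply T e) * zonalKernel n s (inner ℝ u (orthApply T e)) ∂(haarOrth n)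

theorem continuous_orthApply_left (e : Rn n) : Continuous fun T : OrthGroup n => orthApply T e :=
  continuous_orthApply.comp (continuous_id.prodMk continuous_const)

theorem integrable_of_continuous {X : Type*} [TopologicalSpace X] [CompactSpace X]
    [MeasurableSpace X] [OpensMeasurableSpace X] [SecondCountableTopology X] {μ : Measure X}
    [IsFiniteMeasure μ] {f : X → ℝ} (hf : Continuous f) : Integrable f μ :=
  hf.integrable_of_hasCompactSupport (HasCompactSupport.of_compactSpace _)

theorem integrable_zonalAverage (s : ℝ) (e : Rn n) {f : Rn n → ℝ} (hf : Continuous f) (u : Rn n) :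
    Integrable (fun T => f (orthApply T e) * zonalKernel n s (inner ℝ u (orthApply T e)))
      (haarOrth n) := by
  have h1 := continuous_orthApply_left e
  have h2 := continuous_zonalKernel (n := n) s
  exact integrable_of_continuous (by fun_prop)

theorem continuous_zonalAverage (s : ℝ) (e : Rn n) {f : Rn n → ℝ} (hf : Continuous f) :
    Continuous (zonalAverage s e f) := by
  have h1 := continuous_orthApply_left e
  have h2 := continuous_zonalKernel (n := n) s
  have h := continuous_parametric_integral_of_continuous (μ := haarOrth n)
    (f := fun (u : Rn n) T => f (orthApply T e) * zonalKernel n s (inner ℝ u (orthApply T e)))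
    (s := Set.univ) (by simp only [Function.uncurry_def]; fun_prop) isCompact_univ
  simp only [Measure.restrict_univ] at h
  exact h

/-- The kernel is even and `⟨c, ·⟩` is odd; invariance under `-1` shows that the integral equals its
own negative. -/
theorem zonalAverage_inner (s : ℝ) (e c u : Rn n) :
    zonalAverage s e (fun x => inner ℝ c x) u = 0 := by
  have h := integral_mul_left_eq_self (μ := haarOrth n) (fun T => inner ℝ c (orthApply T e) *
    zonalKernel n s (inner ℝ u (orthApply T e))) (-1)
  have hneg : ∀ T : OrthGroup n, orthApply (-1 * T) e = -orthApply T e := fun T => by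
    have : ((-1 : OrthGroup n) : Rn n →L[ℝ] Rn n) = -1 := rfl
    simp [orthApply, this]
  simp only [hneg, inner_neg_right, zonalKernel_neg, neg_mul, integral_neg] at h
  rw [zonalAverage]
  linarith

/-- After normalizing `a`, the average is `‖a‖` times a value of `coshKernel`. -/
theorem zonalAverage_abs_inner_nonneg {s : ℝ} {e a u : Rn n} (he : ‖e‖ = 1) (hu : ‖u‖ = 1) :
    0 ≤ zonalAverage s e (fun x => |inner ℝ a x|) u := by
  rcases eq_or_ne a 0 with rfl | ha
  · simp [zonalAverage]
  have ha' : 0 < ‖a‖ := norm_pos_iff.mpr ha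
  have hx : ‖‖a‖⁻¹ • a‖ = 1 := by
    rw [norm_smul, norm_inv, norm_norm, inv_mul_cancel₀ ha'.ne']
  have h := integral_abs_inner_mul_zonalKernel he hx hu s
  have h2 := coshKernel_nonneg (s * inner ℝ (‖a‖⁻¹ • a) u)
  rw [← h] at h2
  simp only [real_inner_smul_left, abs_mul, abs_inv, abs_norm, mul_assoc] at h2
  rw [integral_const_mul] at h2
  exact nonneg_of_mul_nonneg_right h2 (inv_pos.mpr ha')

theorem zonalAverage_nonneg_of_mem_closure {s : ℝ} {e u : Rn n} (he : ‖e‖ = 1) (hu : ‖u‖ = 1)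
    {f : Rn n → ℝ} (hf : Continuous f) {g : C(Metric.sphere (0 : Rn n) 1, ℝ)}
    (hfg : ∀ x : Metric.sphere (0 : Rn n) 1, f x = g x)
    (hg : g ∈ closure (zonotopeFunctions n)) : 0 ≤ zonalAverage s e f u := by
  set k : OrthGroup n → ℝ := fun T => zonalKernel n s (inner ℝ u (orthApply T e)) with hk
  have hkc : Continuous k := by
    have h1 := continuous_orthApply_left e
    have h2 := continuous_zonalKernel (n := n) s
    fun_prop
  set I := ∫ T, |k T| ∂(haarOrth n) with hI
  have hI0 : 0 ≤ I := integral_nonneg fun T => abs_nonneg _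
  refine le_of_forall_pos_le_add fun ε hε => ?_
  -- `I` is the `L¹` norm of the kernel, so this tolerance costs at most `ε`; the `+ 1` covers `I =
  -- 0`.
  obtain ⟨g', ⟨m, c, a, hg'⟩, hdist⟩ := Metric.mem_closure_iff.mp hg (ε / (I + 1)) (by positivity)
  have hi1 : Integrable (fun T => inner ℝ c (orthApply T e) * k T) (haarOrth n) :=
    integrable_zonalAverage s e (f := fun x => inner ℝ c x) (by fun_prop) u
  have hi2 : ∀ i, Integrable (fun T => |inner ℝ (a i) (orthApply T e)| * k T) (haarOrth n) :=
    fun i => integrable_zonalAverage s e (f := fun x => |inner ℝ (a i) x|) (by fun_prop) u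
  have hi3 := integrable_finsetSum Finset.univ fun i _ => hi2 i
  have hzero : 0 ≤ ∫ T, (inner ℝ c (orthApply T e) * k T +
      ∑ i, |inner ℝ (a i) (orthApply T e)| * k T) ∂(haarOrth n) := by
    rw [integral_add hi1 hi3, integral_finsetSum _ fun i _ => hi2 i]
    refine add_nonneg (zonalAverage_inner s e c u).ge (Finset.sum_nonneg fun i _ => ?_)
    exact zonalAverage_abs_inner_nonneg he hu
  have hki : Integrable (fun T => |k T|) (haarOrth n) := integrable_of_continuous hkc.abs
  have hle : ∫ T, (inner ℝ c (orthApply T e) * k T +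
      ∑ i, |inner ℝ (a i) (orthApply T e)| * k T) ∂(haarOrth n) ≤
      ∫ T, (f (orthApply T e) * k T + ε / (I + 1) * |k T|) ∂(haarOrth n) := by
    refine integral_mono (hi1.add hi3)
      ((integrable_zonalAverage s e hf u).add (hki.const_mul _)) fun T => ?_
    have hx : orthApply T e ∈ Metric.sphere (0 : Rn n) 1 := by
      rw [mem_sphere_zero_iff_norm, orthGroup_norm_apply, he]
    have h1 := (ContinuousMap.dist_apply_le_dist (f := g) (g := g') ⟨_, hx⟩).trans hdist.le
    rw [← hfg, hg', Real.dist_eq] at h1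
    simp only
    rw [← Finset.sum_mul, ← add_mul]
    have h2 : |(f (orthApply T e) - (inner ℝ c (orthApply T e) +
        ∑ i, |inner ℝ (a i) (orthApply T e)|)) * k T| ≤ ε / (I + 1) * |k T| := by
      rw [abs_mul]
      exact mul_le_mul_of_nonneg_right h1 (abs_nonneg _)
    linarith [(abs_le.mp h2).1]
  rw [integral_add (integrable_zonalAverage s e hf u) (hki.const_mul _), integral_const_mul,
    ← hI] at hle
  have hε' : ε / (I + 1) * I ≤ ε := by
    rw [div_mul_eq_mul_div]
    exact div_le_of_le_mul₀ (by positivity) hε.le (by nlinarith)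
  have : zonalAverage s e f u =
      ∫ T, f (orthApply T e) * zonalKernel n s (inner ℝ u (orthApply T e)) ∂(haarOrth n) := rfl
  linarith

theorem zonalAverage_rotate (s : ℝ) (e : Rn n) {u : Rn n} (f : Rn n → ℝ)
    (R : OrthGroup n) (hR : orthApply R u = u) :
    zonalAverage s e (fun x => f (orthApply R x)) u = zonalAverage s e f u := by
  have h := integral_mul_left_eq_self (μ := haarOrth n) (fun T => f (orthApply T e) *
    zonalKernel n s (inner ℝ u (orthApply T e))) R
  rw [zonalAverage, zonalAverage, ← h]
  refine integral_congr_ae (.of_forall fun T => ?_)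
  have hmul : orthApply (R * T) e = orthApply R (orthApply T e) := rfl
  have hin : inner ℝ u (orthApply R (orthApply T e)) = inner ℝ u (orthApply T e) := by
    conv_lhs => rw [← hR]
    exact inner_orthApply R _ _
  simp only [hmul, hin]

/-- This is where spins enter: by Fubini the average over `O(u)` moves outside, and each rotation
fixing `u` leaves the zonal average at `u` unchanged. -/
theorem zonalAverage_spinAverage (s : ℝ) (e u : Rn n) {f : Rn n → ℝ} (hf : Continuous f) :
    zonalAverage s e (spinAverage u f) u = zonalAverage s e f u := by
  have hact := continuous_orthApply (n := n)
  have h1 := continuous_orthApply_left e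
  have h2 := continuous_zonalKernel (n := n) s
  have hc : Continuous (Function.uncurry fun (R : orthStabilizer u) (T : OrthGroup n) =>
      f (orthApply R (orthApply T e)) * zonalKernel n s (inner ℝ u (orthApply T e))) := by
    refine Continuous.mul (hf.comp (hact.comp ((continuous_subtype_val.comp continuous_fst).prodMk
      (h1.comp continuous_snd)))) ?_
    fun_prop
  calc zonalAverage s e (spinAverage u f) u
      = ∫ T, (∫ R : orthStabilizer u, f (orthApply R (orthApply T e)) *
          zonalKernel n s (inner ℝ u (orthApply T e)) ∂(haarO u)) ∂(haarOrth n) := by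
        simp_rw [integral_mul_const]
        rfl
    _ = ∫ R : orthStabilizer u, (∫ T, f (orthApply R (orthApply T e)) *
          zonalKernel n s (inner ℝ u (orthApply T e)) ∂(haarOrth n)) ∂(haarO u) := by
        have : IsFiniteMeasureOnCompacts (haarO u) := inferInstance
        exact (integral_integral_swap_of_hasCompactSupport hc
          (HasCompactSupport.of_compactSpace _)).symm
    _ = ∫ _R : orthStabilizer u, zonalAverage s e f u ∂(haarO u) := by
        refine integral_congr_ae (.of_forall fun R => ?_)
        exact zonalAverage_rotate s e f R R.2
    _ = zonalAverage s e f u := by simp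

theorem zonalAverage_supportFunction_nonneg {s : ℝ} {e u : Rn n} (he : ‖e‖ = 1) (hu : ‖u‖ = 1)
    {K : ConvexBody (Rn n)} (hK : IsZonoid (spin u K)) :
    0 ≤ zonalAverage s e (supportFunction K) u := by
  rw [← zonalAverage_spinAverage s e u (supportFunction_continuous K)]
  have h : spinAverage u (supportFunction K) = supportFunction (spin u K) :=
    funext fun x => (supportFunction_spin u K x).symm
  rw [h]
  exact zonalAverage_nonneg_of_mem_closure he hu (supportFunction_continuous _)
    (fun x => (supportOnSphere_apply _ x).symm) ((isZonoid_iff _).mp hK)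

/-! ### Smoothing -/

/-- The smoothed function `y ↦ ∫ f (T e) Q (s ⟨y, T e⟩) dT`. -/
def smoothing (s : ℝ) (e : Rn n) (f : Rn n → ℝ) (y : Rn n) : ℝ :=
  ∫ T, f (orthApply T e) * coshKernel (s * inner ℝ y (orthApply T e)) ∂(haarOrth n)

theorem integrable_smoothing (s : ℝ) (e : Rn n) {f : Rn n → ℝ} (hf : Continuous f) (y : Rn n) :
    Integrable (fun T => f (orthApply T e) * coshKernel (s * inner ℝ y (orthApply T e)))
      (haarOrth n) := by
  have h1 := continuous_orthApply_left e
  have h2 := continuous_coshKernel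
  exact integrable_of_continuous (by fun_prop)

/-- Fubini moves the cosine transform onto the kernel, where it is known to be `coshKernel`. -/
theorem integral_abs_inner_mul_zonalAverage {s : ℝ} {e y : Rn n} (he : ‖e‖ = 1) (hy : ‖y‖ = 1)
    {f : Rn n → ℝ} (hf : Continuous f) :
    ∫ T, |inner ℝ y (orthApply T e)| * zonalAverage s e f (orthApply T e) ∂(haarOrth n) =
      smoothing s e f y := by
  have h1 := continuous_orthApply_left e
  have h2 := continuous_zonalKernel (n := n) s
  have hc : Continuous (Function.uncurry fun T T' : OrthGroup n =>
      |inner ℝ y (orthApply T e)| * (f (orthApply T' e) *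
        zonalKernel n s (inner ℝ (orthApply T e) (orthApply T' e)))) := by
    simp only [Function.uncurry_def]
    fun_prop
  simp_rw [zonalAverage, ← integral_const_mul]
  rw [integral_integral_swap_of_hasCompactSupport hc (HasCompactSupport.of_compactSpace _),
    smoothing]
  refine integral_congr_ae (.of_forall fun T' => ?_)
  have hT' : ‖orthApply T' e‖ = 1 := by rw [orthGroup_norm_apply, he]
  simp only
  rw [← integral_abs_inner_mul_zonalKernel he hy hT' s, ← integral_const_mul]
  refine integral_congr_ae (.of_forall fun T => ?_)
  simp only
  rw [real_inner_comm (orthApply T' e) (orthApply T e)]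
  ring

theorem smoothing_one_eq {s : ℝ} {e y : Rn n} (he : ‖e‖ = 1) (hy : ‖y‖ = 1) :
    smoothing s e (fun _ => 1) y = smoothing s e (fun _ => 1) e := by
  obtain ⟨S, rfl⟩ := exists_orthApply_eq (he.trans hy.symm)
  have h := integral_mul_left_eq_self (μ := haarOrth n)
    (fun T => (1 : ℝ) * coshKernel (s * inner ℝ (orthApply S e) (orthApply T e))) S
  rw [smoothing, smoothing, ← h]
  refine integral_congr_ae (.of_forall fun T => ?_)
  have hmul : orthApply (S * T) e = orthApply S (orthApply T e) := rfl
  simp only [hmul, inner_orthApply]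

/-- The set is open and contains the identity. -/
theorem abs_inner_gt_measure_pos {e : Rn n} (he : ‖e‖ = 1) {a : ℝ} (ha : a < 1) :
    0 < (haarOrth n).real {T | a < |inner ℝ e (orthApply T e)|} := by
  have h1 := continuous_orthApply_left e
  refine ENNReal.toReal_pos (IsOpen.measure_pos _ ?_ ⟨1, ?_⟩).ne' (measure_ne_top _ _)
  · exact isOpen_lt continuous_const (by fun_prop)
  · simp [orthApply, he, ha]

/-- Markov's inequality, with `coshKernel` monotone in `|z|`; it bounds the normalizing constant
from below by the mass near the poles. -/
theorem smoothing_one_ge (s : ℝ) {a : ℝ} (ha : 0 ≤ a) (e : Rn n) :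
    (haarOrth n).real {T | a < |inner ℝ e (orthApply T e)|} * coshKernel (s * a) ≤
      smoothing s e (fun _ => 1) e := by
  have h := mul_meas_ge_le_integral_of_nonneg (μ := haarOrth n)
    (f := fun T => (1 : ℝ) * coshKernel (s * inner ℝ e (orthApply T e)))
    (.of_forall fun T => by simpa using coshKernel_nonneg _)
    (integrable_smoothing s e continuous_const e) (coshKernel (s * a))
  rw [mul_comm]
  refine le_trans (mul_le_mul_of_nonneg_left (measureReal_mono fun T hT => ?_)
    (coshKernel_nonneg _)) h
  simp only [Set.mem_ofPred_eq, one_mul] at hT ⊢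
  refine coshKernel_mono ?_
  rw [abs_mul, abs_mul, abs_of_nonneg ha]
  exact mul_le_mul_of_nonneg_left hT.le (abs_nonneg s)

/-- Smoothing is an approximate identity on even continuous functions. -/
theorem exists_smoothing_close {e : Rn n} (he : ‖e‖ = 1) {f : Rn n → ℝ} (hf : Continuous f)
    (heven : ∀ x, f (-x) = f x) {ε : ℝ} (hε : 0 < ε) :
    ∃ s : ℝ, 0 < smoothing s e (fun _ => 1) e ∧ ∀ y : Rn n, ‖y‖ = 1 →
      |smoothing s e f y - smoothing s e (fun _ => 1) e * f y| ≤
        ε * smoothing s e (fun _ => 1) e := by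
  obtain ⟨B, hB⟩ := (isCompact_sphere (0 : Rn n) 1).exists_bound_of_continuousOn hf.continuousOn
  have hB' : ∀ x : Rn n, ‖x‖ = 1 → |f x| ≤ B := fun x hx =>
    hB x (mem_sphere_zero_iff_norm.mpr hx)
  have hB0 : 0 ≤ B := (abs_nonneg _).trans (hB' e he)
  obtain ⟨η, hη, hclose⟩ := Metric.uniformContinuousOn_iff.mp
    ((isCompact_sphere (0 : Rn n) 1).uniformContinuousOn_of_continuous hf.continuousOn)
    (ε / 2) (half_pos hε)
  -- For unit vectors `‖x - y‖ ^ 2 = 2 - 2⟨y, x⟩`, which is below `η ^ 2 / 2` once `⟨y, x⟩ > 1 - η ^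
  -- 2 / 4`.
  set b := max 0 (1 - η ^ 2 / 4) with hb
  have hb0 : 0 ≤ b := le_max_left _ _
  have hb1 : b < 1 := max_lt one_pos (by linarith [pow_pos hη 2])
  have hbη : 1 - η ^ 2 / 4 ≤ b := le_max_right _ _
  have hclose' : ∀ x y : Rn n, ‖x‖ = 1 → ‖y‖ = 1 → b < inner ℝ y x →
      |f x - f y| ≤ ε / 2 := by
    intro x y hx hy hxy
    have hd : dist x y < η := by
      rw [dist_eq_norm]
      refine lt_of_pow_lt_pow_left₀ 2 hη.le ?_
      rw [norm_sub_sq_real, hx, hy, real_inner_comm]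
      nlinarith [pow_pos hη 2]
    exact (hclose x (mem_sphere_zero_iff_norm.mpr hx) y (mem_sphere_zero_iff_norm.mpr hy) hd).le
  -- The kernel concentrates at both `y` and `-y`; evenness of `f` makes the second peak harmless.
  have hclose_abs : ∀ x y : Rn n, ‖x‖ = 1 → ‖y‖ = 1 → b < |inner ℝ y x| →
      |f x - f y| ≤ ε / 2 := by
    intro x y hx hy hxy
    rcases lt_abs.mp hxy with h | h
    · exact hclose' x y hx hy h
    · rw [← heven x]
      exact hclose' (-x) y (by rwa [norm_neg]) hy (by rwa [inner_neg_right])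
  set a := (b + 1) / 2 with ha
  have hab : b < a := by linarith
  have ha1 : a < 1 := by linarith
  set p := (haarOrth n).real {T | a < |inner ℝ e (orthApply T e)|} with hp
  have hp0 : 0 < p := abs_inner_gt_measure_pos he ha1
  -- This `δ` makes the contribution `2 B Q(s b)` from outside the caps at most `ε / 2 * N`, since
  -- `N ≥ p Q(s a)`; the `+ 1` covers `B = 0`.
  obtain ⟨s, hs0, hs⟩ := coshKernel_concentration hb0 hab
    (δ := ε * p / (4 * B + 1)) (by positivity)
  have hN := smoothing_one_ge s (hb0.trans hab.le) e
  rw [← hp] at hN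
  set N := smoothing s e (fun _ => 1) e with hNdef
  have hQ0 : 0 < coshKernel (s * a) := by
    obtain ⟨c, hc0, hc⟩ := exists_coshKernel_ge
    have : 0 < s * a := mul_pos hs0 (hb0.trans_lt hab)
    exact lt_of_lt_of_le (by positivity) (hc (s * a))
  have hQb : 2 * B * coshKernel (s * b) ≤ ε / 2 * N := by
    have h1 : 2 * B * coshKernel (s * b) ≤
        2 * B * (ε * p / (4 * B + 1) * coshKernel (s * a)) :=
      mul_le_mul_of_nonneg_left hs (by positivity)
    have h2 : 2 * B * (ε * p / (4 * B + 1) * coshKernel (s * a)) =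
        4 * B / (4 * B + 1) * (ε / 2 * (p * coshKernel (s * a))) := by
      field_simp
      ring
    have h3 : 4 * B / (4 * B + 1) ≤ 1 := (div_le_one (by positivity)).mpr (by linarith)
    have h4 : 0 ≤ ε / 2 * (p * coshKernel (s * a)) := by positivity
    calc _ ≤ _ := h1
      _ ≤ ε / 2 * (p * coshKernel (s * a)) := by
        rw [h2]
        exact mul_le_of_le_one_left h4 h3
      _ ≤ ε / 2 * N := mul_le_mul_of_nonneg_left hN (half_pos hε).le
  refine ⟨s, (mul_pos hp0 hQ0).trans_le hN, fun y hy => ?_⟩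
  have hNy : N = smoothing s e (fun _ => 1) y := (smoothing_one_eq he hy).symm
  have i1 := integrable_smoothing s e hf y
  have i2 := integrable_smoothing s e (f := fun _ => (1 : ℝ)) continuous_const y
  have hdiff : smoothing s e f y - N * f y = ∫ T, (f (orthApply T e) - f y) *
      coshKernel (s * inner ℝ y (orthApply T e)) ∂(haarOrth n) := by
    rw [hNy, smoothing, smoothing, ← integral_mul_const, ← integral_sub i1 (i2.mul_const _)]
    refine integral_congr_ae (.of_forall fun T => ?_)
    ring
  rw [hdiff]
  refine (abs_integral_le_integral_abs).trans ?_
  have hbound : ∫ T, |(f (orthApply T e) - f y) *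
      coshKernel (s * inner ℝ y (orthApply T e))| ∂(haarOrth n) ≤
      ∫ T, (ε / 2 * (1 * coshKernel (s * inner ℝ y (orthApply T e))) +
        2 * B * coshKernel (s * b)) ∂(haarOrth n) := by
    refine integral_mono (((integrable_smoothing s e (f := fun x => f x - f y)
      (by fun_prop) y)).abs) ((i2.const_mul _).add (integrable_const _)) fun T => ?_
    have hT : ‖orthApply T e‖ = 1 := by rw [orthGroup_norm_apply, he]
    have hq := coshKernel_nonneg (s * inner ℝ y (orthApply T e))
    have hqb := coshKernel_nonneg (s * b)
    simp only
    rw [abs_mul, abs_of_nonneg hq, one_mul]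
    rcases lt_or_ge b |inner ℝ y (orthApply T e)| with h | h
    · exact (mul_le_mul_of_nonneg_right (hclose_abs _ _ hT hy h) hq).trans
        (le_add_of_nonneg_right (by positivity))
    · have h1 : coshKernel (s * inner ℝ y (orthApply T e)) ≤ coshKernel (s * b) := by
        refine coshKernel_mono ?_
        rw [abs_mul, abs_mul, abs_of_nonneg hb0]
        exact mul_le_mul_of_nonneg_left h (abs_nonneg s)
      have h2 : |f (orthApply T e) - f y| ≤ 2 * B := by
        have := abs_sub (f (orthApply T e)) (f y)
        linarith [hB' _ hT, hB' _ hy]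
      exact (mul_le_mul h2 h1 hq (by positivity)).trans
        (le_add_of_nonneg_left (by positivity))
  refine hbound.trans ?_
  rw [integral_add (i2.const_mul _) (integrable_const _), integral_const_mul]
  have : ∫ T, (1 : ℝ) * coshKernel (s * inner ℝ y (orthApply T e)) ∂(haarOrth n) = N := hNy.symm
  rw [this]
  simp only [integral_const, probReal_univ, one_smul]
  linarith

/-! ### Bodies whose spins are zonoids -/

/-- A cosine transform with nonnegative density is an average of functions `|⟨a, ·⟩|`: positivity of
the zonal average lets it be absorbed into the vector `a`. -/
theorem smoothing_mem_closure {s : ℝ} {e : Rn n} (he : ‖e‖ = 1) {f : Rn n → ℝ}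
    (hf : Continuous f) (hpos : ∀ u : Rn n, ‖u‖ = 1 → 0 ≤ zonalAverage s e f u)
    {g : C(Metric.sphere (0 : Rn n) 1, ℝ)}
    (hg : ∀ y : Metric.sphere (0 : Rn n) 1, g y = smoothing s e f y) :
    g ∈ closure (zonotopeFunctions n) := by
  have h1 := continuous_orthApply_left e
  have h2 := continuous_zonalAverage s e hf
  have hc : Continuous fun p : OrthGroup n × Metric.sphere (0 : Rn n) 1 =>
      |inner ℝ (p.2 : Rn n) (orthApply p.1 e)| * zonalAverage s e f (orthApply p.1 e) := by
    fun_prop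
  refine mem_closure_zonotopeFunctions_of_integral (haarOrth n)
    (fun T => ⟨fun y => |inner ℝ (y : Rn n) (orthApply T e)| *
      zonalAverage s e f (orthApply T e), by fun_prop⟩)
    (ContinuousMap.continuous_of_continuous_uncurry _ hc)
    (fun T => subset_closure ?_) fun y => ?_
  · have hT : ‖orthApply T e‖ = 1 := by rw [orthGroup_norm_apply, he]
    refine ⟨1, 0, fun _ => zonalAverage s e f (orthApply T e) • orthApply T e, fun y => ?_⟩
    simp only [ContinuousMap.coe_mk, inner_zero_left, zero_add, Finset.univ_unique,
      Finset.sum_singleton, real_inner_smul_left, abs_mul, abs_of_nonneg (hpos _ hT)]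
    rw [mul_comm, real_inner_comm]
  · rw [hg, ← integral_abs_inner_mul_zonalAverage he (mem_sphere_zero_iff_norm.mp y.2) hf]
    rfl

/-- Subtracting `⟨c, ·⟩` translates the centre of symmetry to the origin. -/
theorem supportFunction_sub_inner_even {K : ConvexBody (Rn n)} {c : Rn n}
    (hc : ∀ x ∈ K, (2 : ℝ) • c - x ∈ K) (x : Rn n) :
    supportFunction K (-x) - inner ℝ c (-x) = supportFunction K x - inner ℝ c x := by
  have key : ∀ x, supportFunction K (-x) ≤ supportFunction K x - 2 * inner ℝ c x := by
    intro x
    refine supportFunction_le K _ fun y hy => ?_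
    have h := inner_le_supportFunction K x (hc y hy)
    rw [inner_sub_right, real_inner_smul_right, real_inner_comm] at h
    rw [inner_neg_left]
    linarith
  have h1 := key x
  have h2 := key (-x)
  rw [neg_neg, inner_neg_right] at h2
  rw [inner_neg_right]
  linarith

theorem isZonoid_of_spin {K : ConvexBody (Rn n)} (hK : IsCentrallySymmetric K) {e : Rn n}
    (he : ‖e‖ = 1) (h : ∀ u : Rn n, ‖u‖ = 1 → IsZonoid (spin u K)) : IsZonoid K := by
  obtain ⟨c, hc⟩ := hK
  have hsc := supportFunction_continuous K
  set f : Rn n → ℝ := fun x => supportFunction K x - inner ℝ c x with hfdef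
  have hf : Continuous f := by fun_prop
  have hpos : ∀ s u, ‖u‖ = 1 → 0 ≤ zonalAverage s e f u := by
    intro s u hu
    have h1 : zonalAverage s e f u = zonalAverage s e (supportFunction K) u -
        zonalAverage s e (fun x => inner ℝ c x) u := by
      simp only [zonalAverage]
      rw [← integral_sub (integrable_zonalAverage s e hsc u)
        (integrable_zonalAverage s e (f := fun x => inner ℝ c x) (by fun_prop) u)]
      simp only [hfdef, sub_mul]
    rw [h1, zonalAverage_inner, sub_zero]
    exact zonalAverage_supportFunction_nonneg he hu (h u hu)
  set g : C(Metric.sphere (0 : Rn n) 1, ℝ) := ⟨fun x => f x, by fun_prop⟩ with hg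
  have hgmem : g ∈ closure (zonotopeFunctions n) := by
    -- The approximants `N⁻¹ • W` are themselves only in the closure of the zonotope functions,
    -- hence the second closure.
    rw [← closure_closure, Metric.mem_closure_iff]
    intro ε hε
    obtain ⟨s, hN, hs⟩ := exists_smoothing_close he hf
      (supportFunction_sub_inner_even hc) (half_pos hε)
    set N := smoothing s e (fun _ => 1) e with hNdef
    have hW : Continuous fun y : Metric.sphere (0 : Rn n) 1 => smoothing s e f y := by
      have h1 := continuous_orthApply_left e
      have h2 := continuous_coshKernel
      have h := continuous_parametric_integral_of_continuous (μ := haarOrth n)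
        (f := fun (y : Rn n) T => f (orthApply T e) *
          coshKernel (s * inner ℝ y (orthApply T e)))
        (s := Set.univ) (by simp only [Function.uncurry_def]; fun_prop) isCompact_univ
      simp only [Measure.restrict_univ] at h
      exact h.comp continuous_subtype_val
    let W : C(Metric.sphere (0 : Rn n) 1, ℝ) := ⟨_, hW⟩
    refine ⟨N⁻¹ • W, closure_zonotopeFunctions_smul_mem
      (smoothing_mem_closure he hf (hpos s) fun y => rfl) (inv_nonneg.mpr hN.le), ?_⟩
    refine lt_of_le_of_lt ((ContinuousMap.dist_le (half_pos hε).le).mpr fun y => ?_)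
      (half_lt_self hε)
    have h1 := hs y (mem_sphere_zero_iff_norm.mp y.2)
    rw [dist_comm, Real.dist_eq]
    change |N⁻¹ * smoothing s e f y - f y| ≤ ε / 2
    have h2 : N⁻¹ * smoothing s e f y - f y = N⁻¹ * (smoothing s e f y - N * f y) := by
      field_simp
    rw [h2, abs_mul, abs_of_pos (inv_pos.mpr hN), inv_mul_le_iff₀ hN]
    linarith
  rw [isZonoid_iff]
  have hsum : supportOnSphere K = g + ⟨fun x => inner ℝ c (x : Rn n), by fun_prop⟩ := by
    ext x
    simp [hg, hfdef]
  rw [hsum]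
  exact closure_zonotopeFunctions_add_mem hgmem
    (subset_closure ⟨0, c, Fin.elim0, fun x => by simp⟩)

end

theorem theorem1p1 (n : ℕ) (K : ConvexBody (Rn n)) (hK : IsCentrallySymmetric K) :
    IsZonoid K ↔ ∀ u ∈ Metric.sphere (0 : Rn n) 1, IsZonoid (spin u K) := by
  refine ⟨fun h u _ => h.spin u, fun h => ?_⟩
  -- The sphere is empty only for `n = 0`; then there is no base vector `e`, but all functions on it
  -- coincide.
  rcases (Metric.sphere (0 : Rn n) 1).eq_empty_or_nonempty with hS | ⟨e, he⟩
  · have : IsEmpty (Metric.sphere (0 : Rn n) 1) := Set.isEmpty_coe_sort.mpr hS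
    rw [isZonoid_iff]
    exact subset_closure ⟨0, 0, Fin.elim0, fun x => isEmptyElim x⟩
  · exact isZonoid_of_spin hK (mem_sphere_zero_iff_norm.mp he)
      fun u hu => h u (mem_sphere_zero_iff_norm.mpr hu)
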